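/- Let $\mathbb{P}$ be the set of primes, enumerated increasingly as $p_0=2,p_1=3,\dots$. For $W\subseteq\mathbb{P}$ let $R_W=\mathbb{Z}[\tfrac1p : p\in W]\subseteq\mathbb{Q}$. Give the space $2^{\mathbb{P}}$ of all subsets of $\mathbb{P}$ the product topology, and for a finite binary string $\sigma$ let $\mathcal{U}_\sigma$ be the set of all $W\subseteq\mathbb{P}$ whose characteristic sequence (with respect to $p_0,p_1,\dots$) begins with $\sigma$. For $f\in\mathbb{Z}[X_0,X_1,\dots]$ let $\mathcal{A}(f)$ be the set of all $W$ such that $f$ has a zero in $R_W$. Call $V\subseteq\mathbb{P}$ *HTP-generic* if, for every such $f$, $V$ does not lie in the topological boundary of $\mathcal{A}(f)$. A *diophantine model of $\mathbb{Z}$* in a commutative ring $R$ consists of polynomials $h\in R[X_1,\dots,X_n,\vec Y]$ and $h_+,h_\times\in R[X_1,\dots,X_{3n},\vec Y]$, for some $n$ (where $\vec Y=(Y_0,Y_1,\dots)$), such that the set $$D=\{\vec x\in R^n : \exists \vec y\ \text{in } R\ \ h(\vec x,\vec y)=0\}$$ is isomorphic to $(\mathbb{Z},+,\cdot)$ under the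 binary operations on $D$ whose graphs are the sets $$\{(\vec x_1,\vec x_2,\vec x_3)\in R^{3n} : \exists\vec y\ \text{in } R\ \ h_+(\vec x_1,\vec x_2,\vec x_3,\vec y)=0\}$$ (for addition) and the corresponding set with $h_\times$ (for multiplication). Let $\mathcal{D}$ be the class of all $W\subseteq\mathbb{P}$ such that $R_W$ admits a diophantine model of $\mathbb{Z}$. **Theorem.** One and only one of the following two possibilities holds. 1. The class $\mathcal{D}$ is meager in $2^{\mathbb{P}}$. 2. There exist a triple $(h,h_+,h_\times)$ of polynomials over $\mathbb{Z}$ and a finite binary string $\sigma$ such that, for every HTP-generic $V\in\mathcal{U}_\sigma$, $R_V$ admits a diophantine model of $\mathbb{Z}$ via these three polynomials. If (2) holds, then $\mathbb{P}\in\mathcal{D}$; that is, $\mathbb{Q}$ admits a diophantine model of $\mathbb{Z}$. -/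

import Mathlib

/-- The space `2^ℙ` of sets of primes, each given by its characteristic function, with the product
topology (`Bool` is discrete). -/
abbrev PrimeSet : Type := Nat.Primes → Bool

/-- The `i`-th prime, starting with `2` for `i = 0`. -/
noncomputable def nthPrime (i : ℕ) : Nat.Primes := ⟨Nat.nth Nat.Prime i, Nat.prime_nth_prime i⟩

/-- `𝒰_σ`: the sets `W` of primes whose characteristic sequence begins with the finite binary
string `σ`. -/
def basicOpen (σ : List Bool) : Set PrimeSet :=
  {W | ∀ (i : ℕ) (hi : i < σ.length), W (nthPrime i) = σ[i]}

/-- `R_W = ℤ[1/p : p ∈ W]`, as a subring of `ℚ`. -/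
def ringOf (W : PrimeSet) : Subring ℚ :=
  Subring.closure {q : ℚ | ∃ p : Nat.Primes, W p = true ∧ q = 1 / ((p : ℕ) : ℚ)}

/-- `HTP(R)`: the integer polynomials, in variables indexed by `ℕ`, that have a zero in `R`.
(A polynomial only involves finitely many variables, so one may assign values to all of them.) -/
def HTP (R : Type*) [CommRing R] : Set (MvPolynomial ℕ ℤ) :=
  {f | ∃ r : ℕ → R, MvPolynomial.aeval r f = 0}

/-- `𝒜(f)`: the sets `W` of primes such that `f` has a zero in `R_W`. -/
def solvableSet (f : MvPolynomial ℕ ℤ) : Set PrimeSet := {W | f ∈ HTP (ringOf W)}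

/-- `W` is HTP-generic if it lies on the topological boundary of `𝒜(f)` for no `f`. -/
def IsHTPGeneric (W : PrimeSet) : Prop :=
  ∀ f : MvPolynomial ℕ ℤ, W ∉ frontier (solvableSet f)

section Model

variable {R : Type*} [CommRing R]

/-- The diophantine subset `{x ∈ R^ι : h(x, y) = 0 for some y}` of `R^ι`. The parameters are indexed
by `ι`; the existentially quantified variables by `ℕ`, finitely many of which occur in `h`. -/
def diophSet {ι : Type*} (h : MvPolynomial (ι ⊕ ℕ) R) : Set (ι → R) :=
  {x | ∃ y : ℕ → R, MvPolynomial.eval (Sum.elim x y) h = 0}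

/-- The concatenation of three `n`-tuples. -/
def concat3 {n : ℕ} (x₁ x₂ x₃ : Fin n → R) : Fin 3 × Fin n → R := fun ij =>
  ![x₁, x₂, x₃] ij.1 ij.2

/-- `(h, hadd, hmul)` is a diophantine model of `ℤ` in `R`: there is a bijection `e` from `ℤ` onto
the set defined by `h`, such that the subset of `R^{3n}` defined by `hadd` (by `hmul`) is the graph
of the operation that corresponds under `e` to addition (to multiplication) of integers. -/
def IsDiophantineModel {n : ℕ} (h : MvPolynomial (Fin n ⊕ ℕ) R)
    (hadd hmul : MvPolynomial ((Fin 3 × Fin n) ⊕ ℕ) R) : Prop :=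
  ∃ e : ℤ ≃ diophSet h, ∀ x₁ x₂ x₃ : Fin n → R,
    (concat3 x₁ x₂ x₃ ∈ diophSet hadd ↔
      ∃ a b : ℤ, x₁ = e a ∧ x₂ = e b ∧ x₃ = e (a + b)) ∧
    (concat3 x₁ x₂ x₃ ∈ diophSet hmul ↔
      ∃ a b : ℤ, x₁ = e a ∧ x₂ = e b ∧ x₃ = e (a * b))

end Model

/-- `R` admits a diophantine model of `ℤ` (given by polynomials with coefficients in `R`). -/
def AdmitsDiophantineModel (R : Type*) [CommRing R] : Prop :=
  ∃ (n : ℕ) (h : MvPolynomial (Fin n ⊕ ℕ) R) (hadd hmul : MvPolynomial ((Fin 3 × Fin n) ⊕ ℕ) R),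
    IsDiophantineModel h hadd hmul

/-- `R` admits a diophantine model of `ℤ` via the given integer polynomials. -/
def AdmitsDiophantineModelVia (R : Type*) [CommRing R] {n : ℕ} (h : MvPolynomial (Fin n ⊕ ℕ) ℤ)
    (hadd hmul : MvPolynomial ((Fin 3 × Fin n) ⊕ ℕ) ℤ) : Prop :=
  IsDiophantineModel (MvPolynomial.map (Int.castRingHom R) h)
    (MvPolynomial.map (Int.castRingHom R) hadd) (MvPolynomial.map (Int.castRingHom R) hmul)

/-- The class `𝒟` of all `W` such that `R_W` admits a diophantine model of `ℤ`. -/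
def diophantineClass : Set PrimeSet := {W | AdmitsDiophantineModel (ringOf W)}

/-- Some fixed integer polynomials `(h, hadd, hmul)` give a diophantine model of `ℤ` in `R_V` for
every HTP-generic `V` that extends some fixed finite string `σ`. -/
def UniformGenericModel : Prop :=
  ∃ (n : ℕ) (h : MvPolynomial (Fin n ⊕ ℕ) ℤ) (hadd hmul : MvPolynomial ((Fin 3 × Fin n) ⊕ ℕ) ℤ)
    (σ : List Bool), ∀ V ∈ basicOpen σ, IsHTPGeneric V →
      AdmitsDiophantineModelVia (ringOf V) h hadd hmul

/-! The sets `𝒜(f)` are open and closed under enlarging `W`, and every condition "the rational tuple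
`x` satisfies a given diophantine formula over `R_W`" is one of them (`exists_solvableSet_eq`).
Their boundaries are nowhere dense and countable in number, so the HTP-generic sets are comeager; by
Baire, (2) makes `𝒟` nonmeager.

Conversely, clear denominators and split `𝒟` into countably many pieces, according to the three
integer polynomials and the tuple representing `1`. If `𝒟` is nonmeager, one piece is dense in some
`𝒰_σ`. Any two models there agree: graph facts at `W` and `W'` persist at `W ∪ W'`, hence at some
model near it, and `1` generates the group `ℤ`. So a single map `e` serves all these models. A
generic `V` in `𝒰_σ` inherits the model: its facts hold at nearby models by openness, and facts
common to all the models hold at `V` because `V` avoids boundaries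
(`IsHTPGeneric.exists_isModelAt`).

For `ℚ`, take the largest `V` in `𝒰_σ`. It is generic by monotonicity, and `R_V` is a finite
intersection of localizations `ℤ_(p)`. Each of these is diophantine in `ℚ` (`isDioph_localization`),
so the model moves to `ℚ`. The arithmetic behind this is a norm-form equation: a valuation argument
makes its solutions `p`-integral, while Legendre's theorem with Dirichlet and reciprocity gives it
enough integer solutions. -/

/-! ### Legendre's theorem on ternary quadratic forms -/

theorem exists_ceil_sqrt (n : ℕ) :
    ∃ k : ℕ, n ≤ k ^ 2 ∧ ∀ i j : ℕ, i < k → j < k → ((i : ℤ) - j) ^ 2 < n := by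
  have h : ∃ k : ℕ, n ≤ k ^ 2 := ⟨n, Nat.le_self_pow two_ne_zero n⟩
  classical
  refine ⟨Nat.find h, Nat.find_spec h, fun i j hi hj => ?_⟩
  have key : ∀ i < Nat.find h, (i : ℤ) ^ 2 < n := fun i hi => by
    have := Nat.find_min h hi
    push Not at this
    exact_mod_cast this
  rcases le_total i j with hij | hij
  · have := key j hj
    have hij' : (i : ℤ) ≤ j := by exact_mod_cast hij
    nlinarith [Int.natCast_nonneg i]
  · have := key i hi
    have hij' : (j : ℤ) ≤ i := by exact_mod_cast hij
    nlinarith [Int.natCast_nonneg j]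

/-- Legendre's theorem for `a x² + b y² = c z²` with positive pairwise coprime coefficients. -/
theorem legendre_ternary {a b c : ℕ} (ha : 0 < a) (hb : 0 < b) (hc : 0 < c)
    (hab : a.Coprime b) (hac : a.Coprime c) (hbc : b.Coprime c) (hns : ¬ IsSquare (a * b))
    (h1 : ∃ r : ℤ, (a : ℤ) ∣ r ^ 2 - b * c) (h2 : ∃ s : ℤ, (b : ℤ) ∣ s ^ 2 - a * c)
    (h3 : ∃ t : ℤ, (c : ℤ) ∣ t ^ 2 + a * b) :
    ∃ x y z : ℤ, z ≠ 0 ∧ a * x ^ 2 + b * y ^ 2 = c * z ^ 2 := by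
  obtain ⟨r, hr⟩ := h1
  obtain ⟨s, hs⟩ := h2
  obtain ⟨t, ht⟩ := h3
  obtain ⟨k, hk, hk'⟩ := exists_ceil_sqrt (b * c)
  obtain ⟨l, hl, hl'⟩ := exists_ceil_sqrt (a * c)
  obtain ⟨m, hm, hm'⟩ := exists_ceil_sqrt (a * b)
  -- Since `a * b` is not a square, this inequality is strict, which gives the box one point too
  -- many for the pigeonhole below.
  have hm2 : a * b < m ^ 2 := lt_of_le_of_ne hm fun h => hns ⟨m, by rw [h, sq]⟩
  have hcard : a * b * c < k * l * m := by
    refine lt_of_pow_lt_pow_left₀ 2 (Nat.zero_le _) ?_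
    calc (a * b * c) ^ 2 = (b * c) * (a * c) * (a * b) := by ring
      _ < (b * c) * (a * c) * m ^ 2 := by
        apply Nat.mul_lt_mul_of_pos_left hm2; positivity
      _ ≤ k ^ 2 * l ^ 2 * m ^ 2 := by gcongr
      _ = (k * l * m) ^ 2 := by ring
  have : NeZero a := ⟨ha.ne'⟩
  have : NeZero b := ⟨hb.ne'⟩
  have : NeZero c := ⟨hc.ne'⟩
  -- Modulo each coefficient the form splits into linear factors; a collision of `φ` makes one
  -- factor vanish modulo each of `a`, `b`, `c`.
  let φ : Fin k × Fin l × Fin m → ZMod a × ZMod b × ZMod c := fun v =>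
    (((b * v.2.1 - r * v.2.2 : ℤ) : ZMod a), ((a * v.1 - s * v.2.2 : ℤ) : ZMod b),
      ((a * v.1 - t * v.2.1 : ℤ) : ZMod c))
  obtain ⟨u, v, huv, he⟩ := Fintype.exists_ne_map_eq_of_card_lt φ (by
    simp only [Fintype.card_prod, Fintype.card_fin, ZMod.card]
    calc a * (b * c) = a * b * c := by ring
      _ < k * l * m := hcard
      _ = _ := by ring)
  obtain ⟨i, j, n⟩ := u
  obtain ⟨i', j', n'⟩ := v
  simp only [φ, Prod.mk.injEq, ZMod.intCast_eq_intCast_iff_dvd_sub] at he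
  obtain ⟨e1, e2, e3⟩ := he
  set x : ℤ := (i' : ℤ) - i with hx
  set y : ℤ := (j' : ℤ) - j with hy
  set z : ℤ := (n' : ℤ) - n with hz
  have hx2 : x ^ 2 < b * c := by simpa [hx] using hk' _ _ i'.2 i.2
  have hy2 : y ^ 2 < a * c := by simpa [hy] using hl' _ _ j'.2 j.2
  have hz2 : z ^ 2 < a * b := by simpa [hz] using hm' _ _ n'.2 n.2
  have hne : ¬ (x = 0 ∧ y = 0 ∧ z = 0) := by
    rintro ⟨h1, h2, h3⟩
    apply huv
    simp only [Prod.mk.injEq]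
    refine ⟨Fin.ext ?_, Fin.ext ?_, Fin.ext ?_⟩ <;> omega
  have e1 : (a : ℤ) ∣ b * y - r * z := by convert e1 using 1; rw [hy, hz]; ring
  have e2 : (b : ℤ) ∣ a * x - s * z := by convert e2 using 1; rw [hx, hz]; ring
  have e3 : (c : ℤ) ∣ a * x - t * y := by convert e3 using 1; rw [hx, hy]; ring
  have hab' : IsCoprime (a : ℤ) b := Nat.isCoprime_iff_coprime.2 hab
  have hac' : IsCoprime (a : ℤ) c := Nat.isCoprime_iff_coprime.2 hac
  have hbc' : IsCoprime (b : ℤ) c := Nat.isCoprime_iff_coprime.2 hbc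
  have d1 : (a : ℤ) ∣ a * x ^ 2 + b * y ^ 2 - c * z ^ 2 := by
    refine hab'.dvd_of_dvd_mul_left ?_
    have : (b : ℤ) * (a * x ^ 2 + b * y ^ 2 - c * z ^ 2) =
        a * (b * x ^ 2) + (b * y - r * z) * (b * y + r * z) + (r ^ 2 - b * c) * z ^ 2 := by ring
    rw [this]
    exact ((dvd_mul_right _ _).add (e1.mul_right _)).add (hr.mul_right _)
  have d2 : (b : ℤ) ∣ a * x ^ 2 + b * y ^ 2 - c * z ^ 2 := by
    refine hab'.symm.dvd_of_dvd_mul_left ?_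
    have : (a : ℤ) * (a * x ^ 2 + b * y ^ 2 - c * z ^ 2) =
        b * (a * y ^ 2) + (a * x - s * z) * (a * x + s * z) + (s ^ 2 - a * c) * z ^ 2 := by ring
    rw [this]
    exact ((dvd_mul_right _ _).add (e2.mul_right _)).add (hs.mul_right _)
  have d3 : (c : ℤ) ∣ a * x ^ 2 + b * y ^ 2 - c * z ^ 2 := by
    refine hac'.symm.dvd_of_dvd_mul_left ?_
    have : (a : ℤ) * (a * x ^ 2 + b * y ^ 2 - c * z ^ 2) =
        (a * x - t * y) * (a * x + t * y) + (t ^ 2 + a * b) * y ^ 2 + c * (-(a * z ^ 2)) := by ring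
    rw [this]
    exact ((e3.mul_right _).add (ht.mul_right _)).add (dvd_mul_right _ _)
  have d : (a * b * c : ℤ) ∣ a * x ^ 2 + b * y ^ 2 - c * z ^ 2 :=
    (hac'.mul_left hbc').mul_dvd (hab'.mul_dvd d1 d2) d3
  obtain ⟨w, hw⟩ := d
  have haz : (0 : ℤ) < a := by exact_mod_cast ha
  have hbz : (0 : ℤ) < b := by exact_mod_cast hb
  have hcz : (0 : ℤ) < c := by exact_mod_cast hc
  have hA : (a : ℤ) * x ^ 2 < a * b * c := by
    linarith [mul_lt_mul_of_pos_left hx2 haz]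
  have hB : (b : ℤ) * y ^ 2 < a * b * c := by
    linarith [mul_lt_mul_of_pos_left hy2 hbz]
  have hC : (c : ℤ) * z ^ 2 < a * b * c := by
    linarith [mul_lt_mul_of_pos_left hz2 hcz]
  have hA0 : 0 ≤ (a : ℤ) * x ^ 2 := by positivity
  have hB0 : 0 ≤ (b : ℤ) * y ^ 2 := by positivity
  have hC0 : 0 ≤ (c : ℤ) * z ^ 2 := by positivity
  have habc : (0 : ℤ) < a * b * c := by positivity
  have hw1 : -1 < w := lt_of_mul_lt_mul_left (by linarith) habc.le
  have hw2 : w < 2 := lt_of_mul_lt_mul_left (by linarith) habc.le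
  -- The form is a multiple of `abc` lying strictly between `-abc` and `2abc`.
  obtain rfl | rfl : w = 0 ∨ w = 1 := by omega
  · refine ⟨x, y, z, fun hz0 => hne ?_, by linarith⟩
    rw [hz0] at hw
    have hx0 : (a : ℤ) * x ^ 2 = 0 := by linarith
    have hy0 : (b : ℤ) * y ^ 2 = 0 := by linarith
    simp only [mul_eq_zero, haz.ne', hbz.ne', false_or, pow_eq_zero_iff two_ne_zero] at hx0 hy0
    exact ⟨hx0, hy0, hz0⟩
  -- If the value is `abc`, then `ax² + by² = c(z² + ab)`; multiplying by `z² + ab`, a value of the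
  -- norm form `u² + abv²`, gives a zero by composition of forms.
  · refine ⟨x * z + b * y, y * z - a * x, z ^ 2 + a * b, by positivity, ?_⟩
    linear_combination (z ^ 2 + (a : ℤ) * b) * hw

/-! ### Representations by norm forms, via Dirichlet and reciprocity -/

/-- The quadratic residue symbol, in the form of solvability of the congruence. -/
theorem exists_dvd_sq_sub {l : ℕ} (hl : l.Prime) {n : ℤ} (h : jacobiSym n l = 1) :
    ∃ r : ℤ, (l : ℤ) ∣ r ^ 2 - n := by
  have := Fact.mk hl
  obtain ⟨u, hu⟩ := ZMod.isSquare_of_jacobiSym_eq_one h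
  obtain ⟨r, rfl⟩ := ZMod.intCast_surjective u
  refine ⟨r, (ZMod.intCast_zmod_eq_zero_iff_dvd _ l).1 ?_⟩
  push_cast
  rw [hu]; ring

theorem jacobiSym_eq_one_of_modEq {a : ℤ} {b : ℕ} (h : a ≡ 1 [ZMOD b]) : jacobiSym a b = 1 := by
  rw [jacobiSym.mod_left' h, jacobiSym.one_left]

theorem not_isSquare_mul_of_prime {l q : ℕ} (hl : l.Prime) (h : ¬ l ∣ q) :
    ¬ IsSquare (l * q) := by
  rintro ⟨m, hm⟩
  have h1 : l ∣ m := by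
    have : l ∣ m * m := ⟨q, hm.symm⟩
    exact (hl.dvd_mul.1 this).elim id id
  obtain ⟨k, rfl⟩ := h1
  apply h
  refine ⟨k * k, Nat.eq_of_mul_eq_mul_left hl.pos ?_⟩
  rw [hm]; ring

/-- Dirichlet's theorem with two coprime moduli. -/
theorem exists_prime_modEq_modEq {m n a b : ℕ} (N : ℕ) (hm : m ≠ 0) (hn : n ≠ 0)
    (hmn : m.Coprime n) (ha : a.Coprime m) (hb : b.Coprime n) :
    ∃ l > N, l.Prime ∧ l ≡ a [MOD m] ∧ l ≡ b [MOD n] := by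
  obtain ⟨c, hc1, hc2⟩ := Nat.chineseRemainder hmn a b
  have : c.Coprime (m * n) := by
    refine Nat.Coprime.mul_right ?_ ?_
    · rw [Nat.Coprime, hc1.gcd_eq]; exact ha
    · rw [Nat.Coprime, hc2.gcd_eq]; exact hb
  obtain ⟨l, hl, hlp, hlm⟩ := Nat.forall_exists_prime_gt_and_modEq N (mul_ne_zero hm hn) this
  exact ⟨l, hl, hlp, (hlm.of_mul_right n).trans hc1, (hlm.of_mul_left m).trans hc2⟩

/-- A prime `≡ 1` modulo `q` at which `q ≡ 1 (mod 4)` is a residue is a norm from `ℚ(√q)`. -/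
theorem prime_eq_norm {l q : ℕ} (hl : l.Prime) (hq : q.Prime) (hlo : Odd l)
    (hq4 : q % 4 = 1) (hlq : l ≡ 1 [MOD q]) :
    ∃ a b : ℚ, (l : ℚ) = a ^ 2 - q * b ^ 2 := by
  have hne : ¬ l ∣ q := by
    intro h
    rw [(Nat.prime_dvd_prime_iff_eq hl hq).1 h] at hlq
    have := hlq.symm
    rw [Nat.ModEq, Nat.mod_self, Nat.mod_eq_of_lt hq.one_lt] at this
    exact one_ne_zero this
  have hJ : jacobiSym q l = 1 := by
    rw [jacobiSym.quadratic_reciprocity_one_mod_four hq4 hlo]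
    exact jacobiSym_eq_one_of_modEq (by exact_mod_cast (Int.natCast_modEq_iff.2 hlq))
  obtain ⟨r, hr⟩ := exists_dvd_sq_sub hl hJ
  have hcop : l.Coprime q := (Nat.Prime.coprime_iff_not_dvd hl).2 hne
  -- Solve `l x² + q y² = z²` and divide by `x²`; here `x ≠ 0` because `q` is not a square.
  obtain ⟨x, y, z, hz, h⟩ := legendre_ternary hl.pos hq.pos one_pos hcop (by simp) (by simp)
    (not_isSquare_mul_of_prime hl hne) ⟨r, by simpa using hr⟩
    ⟨1, by
      have := (Int.natCast_modEq_iff.2 hlq).dvd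
      simpa using this⟩ ⟨0, by simp⟩
  have hx : x ≠ 0 := by
    rintro rfl
    have h' : (q : ℤ) * y ^ 2 = z ^ 2 := by simpa using h
    apply hq.prime.irreducible.not_isSquare
    have hy : y ≠ 0 := by rintro rfl; simp at h'; exact hz (pow_eq_zero_iff two_ne_zero |>.1 h'.symm)
    have : (y : ℤ) ^ 2 ∣ z ^ 2 := ⟨q, by rw [← h']; ring⟩
    obtain ⟨w, rfl⟩ := (Int.pow_dvd_pow_iff two_ne_zero).1 this
    refine ⟨w.natAbs, ?_⟩
    have : (q : ℤ) = w * w := by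
      have hy2 : (y : ℤ) ^ 2 ≠ 0 := pow_ne_zero _ hy
      apply mul_right_cancel₀ hy2
      rw [h']; ring
    have h3 := Int.natAbs_mul_self (a := w)
    exact_mod_cast this.trans h3.symm
  refine ⟨z / x, y / x, ?_⟩
  have hxq : (x : ℚ) ≠ 0 := by exact_mod_cast hx
  have hq' : (l : ℚ) * x ^ 2 + q * y ^ 2 = 1 * z ^ 2 := by exact_mod_cast h
  field_simp
  linarith

/-- With `x = 2qy` this reads `1 + p(x² - q d²) = a² - q b²`, the equation of
`EvenNormForm.not_dvd_den` for `c = 0`. It follows from solving `l X² + pq Y² = A Z²` for an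
auxiliary prime `l` that is itself a norm from `ℚ(√q)`. -/
theorem exists_repr_of_odd_prime {p q : ℕ} (hp : p.Prime) (hp2 : p ≠ 2) (hq : q.Prime)
    (hq4 : q % 4 = 1) (y : ℕ) :
    ∃ a b d : ℚ, 1 + p * (2 * q * y) ^ 2 = a ^ 2 - q * b ^ 2 + p * q * d ^ 2 := by
  set A : ℕ := 1 + p * (2 * q * y) ^ 2 with hA
  have hpo : Odd p := hp.odd_of_ne_two hp2
  have hqo : Odd q := Nat.odd_iff.2 (by omega)
  have hA4 : A.Coprime (4 * p * q) := by
    refine Nat.Coprime.mul_right (Nat.Coprime.mul_right ?_ ?_) ?_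
    · rw [show A = 1 + (p * (q * y) ^ 2) * 4 by rw [hA]; ring]; simp
    · rw [show A = 1 + (2 * q * y) ^ 2 * p by rw [hA]; ring]; simp
    · rw [show A = 1 + (p * 4 * q * y ^ 2) * q by rw [hA]; ring]; simp
  have hAq : A.Coprime q := hA4.coprime_dvd_right (dvd_mul_left _ _)
  -- `l ≡ 1` modulo `4pq` makes `l` a norm and `p`, `q` residues modulo `l`; `l ≡ q` modulo `A`
  -- gives `(A/l) = (l/A) = (q/A) = (A/q) = 1`.
  obtain ⟨l, hl, hlp, hl1, hl2⟩ := exists_prime_modEq_modEq (a := 1) (b := q) 2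
    (show 4 * p * q ≠ 0 by simp [hp.ne_zero, hq.ne_zero])
    (show A ≠ 0 by omega) hA4.symm (by simp) hAq.symm
  have hlo : Odd l := hlp.odd_of_ne_two (by omega)
  have hl4 : l % 4 = 1 := by
    have : l ≡ 1 [MOD 4] := hl1.of_mul_right q |>.of_mul_right p
    simpa [Nat.ModEq] using this
  have hlq : l ≡ 1 [MOD q] := hl1.of_mul_left _
  have hlP : l ≡ 1 [MOD p] := hl1.of_mul_right q |>.of_mul_left 4
  have hlpq : l ≡ 1 [MOD p * q] := by
    rw [mul_assoc] at hl1; exact hl1.of_mul_left 4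
  have hAo : Odd A := ⟨p * (2 * q ^ 2 * y ^ 2), by rw [hA]; ring⟩
  have jA : jacobiSym A l = 1 := by
    rw [jacobiSym.quadratic_reciprocity_one_mod_four' hAo hl4,
      jacobiSym.mod_left' (Int.natCast_modEq_iff.2 hl2),
      jacobiSym.quadratic_reciprocity_one_mod_four hq4 hAo]
    apply jacobiSym_eq_one_of_modEq
    rw [Int.modEq_iff_dvd]
    exact ⟨-(p * 4 * q * y ^ 2), by rw [hA]; push_cast; ring⟩
  have jp : jacobiSym p l = 1 := by
    rw [jacobiSym.quadratic_reciprocity_one_mod_four' hpo hl4]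
    exact jacobiSym_eq_one_of_modEq (by exact_mod_cast Int.natCast_modEq_iff.2 hlP)
  have jq : jacobiSym q l = 1 := by
    rw [jacobiSym.quadratic_reciprocity_one_mod_four' hqo hl4]
    exact jacobiSym_eq_one_of_modEq (by exact_mod_cast Int.natCast_modEq_iff.2 hlq)
  obtain ⟨r, hr⟩ := exists_dvd_sq_sub hlp (n := p * q * A) (by
    rw [jacobiSym.mul_left, jacobiSym.mul_left, jp, jq, jA]; norm_num)
  have c1 : l.Coprime (p * q) := by rw [Nat.Coprime, hlpq.gcd_eq]; simp
  have c2 : l.Coprime A := by rw [Nat.Coprime, hl2.gcd_eq]; exact hAq.symm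
  have c3 : (p * q).Coprime A :=
    (hA4.coprime_dvd_right ⟨4, by ring⟩).symm
  obtain ⟨X, Y, Z, hZ, h⟩ := legendre_ternary hlp.pos (Nat.mul_pos hp.pos hq.pos) (by omega)
    c1 c2 c3 (not_isSquare_mul_of_prime hlp fun h => by
      have := Nat.eq_one_of_dvd_coprimes c1 dvd_rfl h
      exact hlp.one_lt.ne' this)
    ⟨r, by exact_mod_cast hr⟩ ⟨1, by
      have h1 : (l : ℤ) * A ≡ 1 * 1 [ZMOD (p * q : ℕ)] := by
        refine Int.ModEq.mul (by exact_mod_cast Int.natCast_modEq_iff.2 hlpq) ?_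
        exact (Int.modEq_iff_dvd.2 ⟨(4 * q * y ^ 2 : ℤ), by rw [hA]; push_cast; ring⟩).symm
      simpa using h1.dvd⟩
    -- Modulo `A`, `p(2qy)² ≡ -1` and `l ≡ q`, so the square of this witness is `-pq² ≡ -l·pq`.
    ⟨p * q * (2 * q * y), by
      obtain ⟨k, hk⟩ := (Int.natCast_modEq_iff.2 hl2).symm.dvd
      refine ⟨p * q ^ 2 + k * (p * q), ?_⟩
      have : (l : ℤ) = q + A * k := by linarith
      rw [this, hA]; push_cast; ring⟩
  obtain ⟨a, b, hab⟩ := prime_eq_norm hlp hq hlo hq4 hlq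
  have hZq : (Z : ℚ) ≠ 0 := by exact_mod_cast hZ
  have h' : (l : ℚ) * X ^ 2 + (p * q) * Y ^ 2 = (1 + p * (2 * q * y) ^ 2) * Z ^ 2 := by
    exact_mod_cast h
  refine ⟨a * (X / Z), b * (X / Z), Y / Z, ?_⟩
  rw [hab] at h'
  field_simp
  linear_combination -h'

/-- The analogue at `2`, with `q = 5` and `c = 1`: for `x = 5y` it reads `4 + 2(x² - 5d²) = a² -
5b²`. Oddness of `y` fixes `B` modulo `8`, as reciprocity requires. -/
theorem exists_repr_two {y : ℕ} (hy : Odd y) :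
    ∃ a b d : ℚ, 2 * (2 + (5 * y) ^ 2) = a ^ 2 - 5 * b ^ 2 + 10 * d ^ 2 := by
  set B : ℕ := 2 + (5 * y) ^ 2 with hB
  have hB8 : B % 8 = 3 := by
    obtain ⟨k, rfl⟩ := hy
    obtain ⟨j, hj⟩ := Nat.even_mul_succ_self k
    have : B = 27 + 100 * (k * (k + 1)) := by rw [hB]; ring
    rw [this, hj]; omega
  have hBo : Odd B := Nat.odd_iff.2 (by omega)
  have hB5 : B.Coprime 5 := by
    rw [show B = 2 + (5 * y ^ 2) * 5 by rw [hB]; ring]; simp; norm_num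
  have hB20 : B.Coprime 20 := by
    refine Nat.Coprime.mul_right (m := 4) (n := 5) ?_ hB5
    exact Nat.Coprime.pow_right 2 (Nat.coprime_two_right.2 hBo)
  -- `11` is `3` modulo `4` and `1` modulo `5`. As `B ≡ 3` modulo `4` too, reciprocity contributes a
  -- sign: `(B/l) = -(l/B) = -(5/B) = -(B/5) = -(2/5) = 1`.
  obtain ⟨l, hl, hlp, hl1, hl2⟩ := exists_prime_modEq_modEq (a := 11) (b := 5) 5
    (show 20 ≠ 0 by simp) (show B ≠ 0 by omega) hB20.symm (by norm_num) hB5.symm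
  have hlo : Odd l := hlp.odd_of_ne_two (by omega)
  have hl4 : l % 4 = 3 := by have : l % 20 = 11 % 20 := hl1; omega
  have hl5 : l ≡ 1 [MOD 5] := by have : l % 20 = 11 % 20 := hl1; show l % 5 = 1 % 5; omega
  have j5 : jacobiSym (5 : ℕ) l = 1 := by
    rw [jacobiSym.quadratic_reciprocity_one_mod_four (by norm_num) hlo]
    exact jacobiSym_eq_one_of_modEq (by exact_mod_cast Int.natCast_modEq_iff.2 hl5)
  have jB : jacobiSym B l = 1 := by
    rw [jacobiSym.quadratic_reciprocity_three_mod_four (by omega) hl4,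
      jacobiSym.mod_left' (Int.natCast_modEq_iff.2 hl2),
      jacobiSym.quadratic_reciprocity_one_mod_four (by norm_num) hBo,
      jacobiSym.mod_left' (b := 5) (a₂ := 2) (by rw [hB]; push_cast; ring_nf; omega)]
    norm_num
  obtain ⟨r, hr⟩ := exists_dvd_sq_sub hlp (n := 5 * B) (by
    rw [jacobiSym.mul_left, jB]; exact_mod_cast congrArg (· * (1 : ℤ)) j5)
  -- Adding the odd number `l` if necessary makes the root odd, which settles the congruence modulo
  -- `2`.
  obtain ⟨r, hr⟩ : ∃ r : ℤ, ((2 * l : ℕ) : ℤ) ∣ r ^ 2 - 5 * B := by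
    have hcop : IsCoprime (2 : ℤ) l := by
      exact_mod_cast Nat.isCoprime_iff_coprime.2 (Nat.coprime_two_left.2 hlo)
    have hB2 : (B : ℤ) % 2 = 1 := by omega
    have key : ∀ s : ℤ, s % 2 = 1 → (2 : ℤ) ∣ s ^ 2 - 5 * B := by
      intro s hs
      have h1 : s ^ 2 % 2 = 1 := by rw [pow_two, Int.mul_emod, hs]; norm_num
      omega
    rcases Int.emod_two_eq_zero_or_one r with h0 | h1
    · refine ⟨r + l, ?_⟩
      push_cast
      refine hcop.mul_dvd (key _ ?_) ?_
      · have : (l : ℤ) % 2 = 1 := by omega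
        omega
      · rw [show (r + l) ^ 2 - 5 * (B : ℤ) = (r ^ 2 - 5 * B) + l * (2 * r + l) by ring]
        exact hr.add (dvd_mul_right _ _)
    · exact ⟨r, by push_cast; exact hcop.mul_dvd (key _ h1) hr⟩
  have c1 : (2 * l).Coprime 5 := by
    refine Nat.Coprime.mul_left (by norm_num) ?_
    rw [Nat.Coprime, hl5.gcd_eq]; simp
  have c2 : (2 * l).Coprime B := by
    refine Nat.Coprime.mul_left (Nat.coprime_two_left.2 hBo) ?_
    rw [Nat.Coprime, hl2.gcd_eq]; exact hB5.symm
  obtain ⟨X, Y, Z, hZ, h⟩ := legendre_ternary (a := 2 * l) (b := 5) (c := B)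
    (by have := hlp.pos; omega) (by norm_num) (by omega)
    c1 c2 hB5.symm (by
      rw [mul_assoc]
      exact not_isSquare_mul_of_prime Nat.prime_two (by omega))
    ⟨r, by exact_mod_cast hr⟩ ⟨2, by
      have h1 : ((2 * l : ℕ) : ℤ) * B ≡ 2 * 1 * 2 [ZMOD (5 : ℕ)] := by
        rw [Nat.cast_mul, Nat.cast_ofNat]
        have h5 : (l : ℤ) ≡ 1 [ZMOD 5] := by exact_mod_cast Int.natCast_modEq_iff.2 hl5
        refine Int.ModEq.mul (Int.ModEq.mul rfl h5) ?_
        exact (Int.modEq_iff_dvd.2 ⟨(5 * y ^ 2 : ℤ), by rw [hB]; push_cast; ring⟩).symm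
      simpa using h1.dvd⟩
    ⟨5 * (5 * y), by
      obtain ⟨k, hk⟩ := (Int.natCast_modEq_iff.2 hl2).symm.dvd
      refine ⟨25 + k * 10, ?_⟩
      have : (l : ℤ) = 5 + B * k := by push_cast at hk; linarith
      push_cast
      rw [this, hB]; push_cast; ring⟩
  obtain ⟨a, b, hab⟩ := prime_eq_norm hlp (q := 5) Nat.prime_five hlo (by norm_num) hl5
  have hZq : (Z : ℚ) ≠ 0 := by exact_mod_cast hZ
  have h' : (2 * l : ℚ) * X ^ 2 + 5 * Y ^ 2 = (2 + (5 * y) ^ 2) * Z ^ 2 := by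
    exact_mod_cast h
  refine ⟨2 * a * (X / Z), 2 * b * (X / Z), Y / Z, ?_⟩
  rw [hab] at h'
  push_cast at h'
  field_simp
  linear_combination -2 * h'

/-! ### Valuations of norm forms -/

theorem not_dvd_den_of_mul_eq {p : ℕ} {x : ℚ} {D N : ℤ} (hD : ¬ (p : ℤ) ∣ D) (h : x * D = N) :
    ¬ p ∣ x.den := by
  intro hp
  have hD0 : (D : ℚ) ≠ 0 := by
    intro h0
    apply hD
    rw [Int.cast_eq_zero.1 h0]; exact dvd_zero _
  have hx : x = (N : ℚ) / D := by rw [← h]; field_simp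
  have := Rat.den_dvd N D
  rw [Rat.divInt_eq_div, ← hx] at this
  exact hD ((Int.natCast_dvd_natCast.2 hp).trans this)

theorem pow_mul_exponent_unique {p : ℕ} (hp : p.Prime) {i j : ℕ} {u w : ℤ}
    (hu : ¬ (p : ℤ) ∣ u) (hw : ¬ (p : ℤ) ∣ w) (h : (p : ℤ) ^ i * u = p ^ j * w) : i = j := by
  have hp0 : (p : ℤ) ≠ 0 := by exact_mod_cast hp.ne_zero
  have key : ∀ {i j : ℕ} {u w : ℤ}, ¬ (p : ℤ) ∣ u → (p : ℤ) ^ i * u = p ^ j * w → ¬ i < j := by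
    intro i j u w hu h hij
    obtain ⟨k, rfl⟩ := Nat.exists_eq_add_of_lt hij
    apply hu
    refine ⟨p ^ k * w, mul_left_cancel₀ (pow_ne_zero i hp0) ?_⟩
    rw [h]; ring
  have h1 := key hu h
  have h2 := key hw h.symm
  omega

section NormForm

/-- A binary form `a² - q b²` whose primitive values have even `p`-adic valuation at most `2c`. -/
def EvenNormForm (p : ℕ) (q : ℤ) (c : ℕ) : Prop :=
  ∀ a b : ℤ, ((p : ℤ) ∣ a ∧ (p : ℤ) ∣ b) ∨
    ∃ k ≤ c, ∃ u : ℤ, ¬ (p : ℤ) ∣ u ∧ a ^ 2 - q * b ^ 2 = p ^ (2 * k) * u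

variable {p : ℕ} {q : ℤ} {c : ℕ}

/-- Descent: a common factor `p` of `a` and `b` raises the valuation by exactly `2`, so the
primitive case decides parity and bounds the loss by `p ^ c`. -/
theorem EvenNormForm.exists_eq (hp : p.Prime) (H : EvenNormForm p q c) (a b : ℤ)
    (hab : a ≠ 0 ∨ b ≠ 0) :
    ∃ (k : ℕ) (u : ℤ), ¬ (p : ℤ) ∣ u ∧ a ^ 2 - q * b ^ 2 = p ^ (2 * k) * u ∧
      (p : ℤ) ^ k ∣ p ^ c * a := by
  induction hn : a.natAbs + b.natAbs using Nat.strong_induction_on generalizing a b with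
  | _ n ih =>
    rcases H a b with ⟨⟨a, rfl⟩, ⟨b, rfl⟩⟩ | ⟨k, hk, u, hu, h⟩
    · have hab' : a ≠ 0 ∨ b ≠ 0 := hab.imp (fun h h0 => h (by simp [h0])) fun h h0 => h (by simp [h0])
      have hlt : a.natAbs + b.natAbs < n := by
        rw [← hn, Int.natAbs_mul, Int.natAbs_mul, Int.natAbs_natCast, ← mul_add]
        have : 0 < a.natAbs + b.natAbs := by omega
        nlinarith [hp.two_le]
      obtain ⟨k, u, hu, h, hd⟩ := ih _ hlt a b hab' rfl
      refine ⟨k + 1, u, hu, ?_, ?_⟩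
      · linear_combination (p : ℤ) ^ 2 * h
      · rw [pow_succ, show (p : ℤ) ^ c * (p * a) = (p ^ c * a) * p by ring]
        exact mul_dvd_mul_right hd _
    · exact ⟨k, u, hu, h, (pow_dvd_pow _ hk).mul_right _⟩

/-- The term `p(x² - q d²)` has odd valuation unless `x = d = 0`, while the right side, if nonzero,
has even valuation. A denominator of `x` divisible by `p` would make the odd term dominate. -/
theorem EvenNormForm.not_dvd_den (hp : p.Prime) (H : EvenNormForm p q c) {x d a b : ℚ}
    (h : (p : ℚ) ^ (2 * c) + p * (x ^ 2 - q * d ^ 2) = a ^ 2 - q * b ^ 2) : ¬ p ∣ x.den := by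
  have hp0 : (p : ℤ) ≠ 0 := by exact_mod_cast hp.ne_zero
  have hpp : Prime (p : ℤ) := Nat.prime_iff_prime_int.1 hp
  obtain ⟨D, X, d', a', b', hD, hX, hd, ha, hb⟩ : ∃ D X d' a' b' : ℤ, D ≠ 0 ∧ x * D = X ∧
      d * D = d' ∧ a * D = a' ∧ b * D = b' := by
    refine ⟨x.den * d.den * a.den * b.den, x.num * d.den * a.den * b.den,
      x.den * d.num * a.den * b.den, x.den * d.den * a.num * b.den,
      x.den * d.den * a.den * b.num, by positivity, ?_, ?_, ?_, ?_⟩ <;> push_cast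
    · rw [← Rat.mul_den_eq_num x]; ring
    · rw [← Rat.mul_den_eq_num d]; ring
    · rw [← Rat.mul_den_eq_num a]; ring
    · rw [← Rat.mul_den_eq_num b]; ring
  have hZ : (p : ℤ) ^ (2 * c) * D ^ 2 + p * (X ^ 2 - q * d' ^ 2) = a' ^ 2 - q * b' ^ 2 := by
    have : (p : ℚ) ^ (2 * c) * D ^ 2 + p * (X ^ 2 - q * d' ^ 2) = a' ^ 2 - q * b' ^ 2 := by
      rw [← hX, ← hd, ← ha, ← hb]
      linear_combination (D : ℚ) ^ 2 * h
    exact_mod_cast this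
  by_cases hx0 : X = 0 ∧ d' = 0
  · have : x = 0 := by
      have hDq : (D : ℚ) ≠ 0 := by exact_mod_cast hD
      rw [hx0.1] at hX
      simpa [hDq] using hX
    rw [this]
    simpa using hp.one_lt.ne'
  obtain ⟨k, u, hu, hk, hkX⟩ := H.exists_eq hp X d' (by tauto)
  obtain ⟨e, D', hD', rfl⟩ : ∃ (e : ℕ) (D' : ℤ), ¬ (p : ℤ) ∣ D' ∧ D = p ^ e * D' := by
    have hf : FiniteMultiplicity (p : ℤ) D := Int.finiteMultiplicity_iff.2 ⟨by
      simpa using hp.one_lt.ne', hD⟩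
    obtain ⟨D', h1, h2⟩ := hf.exists_eq_pow_mul_and_not_dvd
    exact ⟨_, D', h2, h1⟩
  -- After clearing denominators the two terms on the left have valuations `2c + 2e` and `2k + 1`;
  -- were the latter smaller, it would be the valuation of the norm on the right.
  have hle : c + e ≤ k := by
    by_contra hlt
    push Not at hlt
    obtain ⟨j, hj⟩ : ∃ j, 2 * c + 2 * e = (2 * k + 1) + (j + 1) :=
      ⟨2 * c + 2 * e - 2 * k - 2, by omega⟩
    have hN : a' ^ 2 - q * b' ^ 2 = p ^ (2 * k + 1) * (u + p * (p ^ j * D' ^ 2)) := by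
      rw [← hZ, hk]
      have : (p : ℤ) ^ (2 * c) * (p ^ e * D') ^ 2 = p ^ (2 * c + 2 * e) * D' ^ 2 := by ring
      rw [this, hj]; ring
    have hu' : ¬ (p : ℤ) ∣ u + p * (p ^ j * D' ^ 2) := fun h =>
      hu ((dvd_add_left (dvd_mul_right _ _)).1 h)
    by_cases hab : a' ≠ 0 ∨ b' ≠ 0
    · obtain ⟨m, w, hw, hm, -⟩ := H.exists_eq hp a' b' hab
      have := pow_mul_exponent_unique hp hu' hw (hN.symm.trans hm)
      omega
    · push Not at hab
      rw [hab.1, hab.2] at hN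
      have h0 : u + p * (p ^ j * D' ^ 2) = 0 := by
        have : (p : ℤ) ^ (2 * k + 1) * (u + p * (p ^ j * D' ^ 2)) = 0 := by rw [← hN]; ring
        exact (mul_eq_zero.1 this).resolve_left (pow_ne_zero _ hp0)
      exact hu' (h0 ▸ dvd_zero _)
  have hXe : (p : ℤ) ^ e ∣ X := by
    have := (pow_dvd_pow (p : ℤ) hle).trans hkX
    rw [pow_add] at this
    exact (mul_dvd_mul_iff_left (pow_ne_zero c hp0)).1 this
  obtain ⟨X', rfl⟩ := hXe
  refine not_dvd_den_of_mul_eq (N := X') hD' ?_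
  have hpe : (p : ℚ) ^ e ≠ 0 := pow_ne_zero _ (by exact_mod_cast hp.ne_zero)
  apply mul_left_cancel₀ hpe
  push_cast at hX
  linear_combination hX

end NormForm

theorem evenNormForm_of_nonresidue {p q : ℕ} [Fact p.Prime] (h : jacobiSym q p = -1) :
    EvenNormForm p q 0 := by
  intro a b
  by_cases hd : (p : ℤ) ∣ a ^ 2 - q * b ^ 2
  · exact Or.inl (jacobiSym.prime_dvd_of_eq_neg_one h hd)
  · exact Or.inr ⟨0, le_rfl, _, hd, by simp⟩

/-- When `a` and `b` are both odd, `a² - 5b²` is `4` times an odd number; this case forces `c = 1`.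
-/
theorem evenNormForm_two_five : EvenNormForm 2 5 1 := by
  intro a b
  rcases Int.emod_two_eq_zero_or_one a with ha | ha <;>
    rcases Int.emod_two_eq_zero_or_one b with hb | hb
  · exact Or.inl ⟨by push_cast; omega, by push_cast; omega⟩
  all_goals right
  · refine ⟨0, by norm_num, _, ?_, by simp; rfl⟩
    obtain ⟨a, rfl⟩ : ∃ k, a = 2 * k := ⟨a / 2, by omega⟩
    obtain ⟨b, rfl⟩ : ∃ k, b = 2 * k + 1 := ⟨b / 2, by omega⟩
    ring_nf; omega
  · refine ⟨0, by norm_num, _, ?_, by simp; rfl⟩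
    obtain ⟨a, rfl⟩ : ∃ k, a = 2 * k + 1 := ⟨a / 2, by omega⟩
    obtain ⟨b, rfl⟩ : ∃ k, b = 2 * k := ⟨b / 2, by omega⟩
    ring_nf; omega
  · obtain ⟨a, rfl⟩ : ∃ k, a = 2 * k + 1 := ⟨a / 2, by omega⟩
    obtain ⟨b, rfl⟩ : ∃ k, b = 2 * k + 1 := ⟨b / 2, by omega⟩
    obtain ⟨i, hi⟩ := Int.even_mul_succ_self a
    obtain ⟨j, hj⟩ := Int.even_mul_succ_self b
    refine ⟨1, le_rfl, 2 * i - 10 * j - 1, by push_cast; omega, ?_⟩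
    push_cast
    linear_combination 4 * hi - 20 * hj

theorem exists_prime_one_mod_four_nonresidue {p : ℕ} (hp : p.Prime) (hp2 : p ≠ 2) :
    ∃ q : ℕ, q.Prime ∧ q % 4 = 1 ∧ jacobiSym q p = -1 := by
  have := Fact.mk hp
  obtain ⟨u, hu⟩ := FiniteField.exists_nonsquare (F := ZMod p) (by rwa [ZMod.ringChar_zmod_n])
  have hu0 : u ≠ 0 := by rintro rfl; exact hu (IsSquare.zero)
  have hcop : (4 : ℕ).Coprime p :=
    Nat.Coprime.pow_left 2 ((Nat.coprime_primes Nat.prime_two hp).2 hp2.symm)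
  have hval : u.val.Coprime p := by
    rw [Nat.coprime_comm, hp.coprime_iff_not_dvd]
    intro h
    rw [← ZMod.natCast_eq_zero_iff, ZMod.natCast_zmod_val] at h
    exact hu0 h
  obtain ⟨q, -, hqp, h1, h2⟩ := exists_prime_modEq_modEq (a := 1) (b := u.val) 0
    (show 4 ≠ 0 by norm_num) hp.ne_zero hcop (by norm_num) hval
  refine ⟨q, hqp, h1, ?_⟩
  rw [ZMod.nonsquare_iff_jacobiSym_eq_neg_one]
  have : (q : ZMod p) = u := by
    rw [(ZMod.natCast_eq_natCast_iff _ _ _).2 h2, ZMod.natCast_zmod_val]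
  push_cast
  rwa [this]

/-! ### Closure properties of diophantine sets -/

section Dioph

variable {R : Type*} [CommRing R] {ι κ : Type*}

/-- A subset of `R^ι` is diophantine if it is defined by a polynomial over `R`. -/
def IsDioph (S : Set (ι → R)) : Prop := ∃ h : MvPolynomial (ι ⊕ ℕ) R, diophSet h = S

theorem isDioph_zeroLocus (f : MvPolynomial ι R) : IsDioph {x | MvPolynomial.eval x f = 0} := by
  refine ⟨MvPolynomial.rename Sum.inl f, Set.ext fun x => ?_⟩
  simp [diophSet, MvPolynomial.eval_rename]

theorem IsDioph.preimage {S : Set (κ → R)} (hS : IsDioph S) (φ : κ → MvPolynomial ι R) :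
    IsDioph {x : ι → R | (fun k => MvPolynomial.eval x (φ k)) ∈ S} := by
  obtain ⟨h, rfl⟩ := hS
  refine ⟨MvPolynomial.bind₁ (Sum.elim (fun k => MvPolynomial.rename Sum.inl (φ k))
    fun j => MvPolynomial.X (Sum.inr j)) h, Set.ext fun x => ?_⟩
  simp only [diophSet, Set.mem_ofPred_eq]
  refine exists_congr fun y => ?_
  rw [← MvPolynomial.coe_aeval_eq_eval, ← MvPolynomial.coe_aeval_eq_eval, RingHom.coe_coe,
    RingHom.coe_coe, MvPolynomial.aeval_bind₁]
  have : (fun i => MvPolynomial.aeval (Sum.elim x y)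
      (Sum.elim (fun k => MvPolynomial.rename Sum.inl (φ k))
        (fun j => (MvPolynomial.X (Sum.inr j) : MvPolynomial (ι ⊕ ℕ) R)) i)) =
      Sum.elim (fun k => MvPolynomial.eval x (φ k)) y := by
    funext i
    rcases i with k | j
    · simp only [Sum.elim_inl, MvPolynomial.aeval_rename, Sum.elim_comp_inl]
      exact DFunLike.congr_fun (MvPolynomial.coe_aeval_eq_eval x) (φ k)
    · simp
  rw [this]

theorem IsDioph.exists [Countable κ] {S : Set (ι ⊕ κ → R)} (hS : IsDioph S) :
    IsDioph {x : ι → R | ∃ y : κ → R, Sum.elim x y ∈ S} := by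
  obtain ⟨h, rfl⟩ := hS
  obtain ⟨f, hf⟩ := exists_injective_nat (κ ⊕ ℕ)
  refine ⟨MvPolynomial.rename (Sum.elim (Sum.elim Sum.inl fun k => Sum.inr (f (Sum.inl k)))
    fun j => Sum.inr (f (Sum.inr j))) h, Set.ext fun x => ?_⟩
  simp only [diophSet, Set.mem_ofPred_eq, MvPolynomial.eval_rename]
  have key : ∀ y : ℕ → R, Sum.elim x y ∘ (Sum.elim (Sum.elim Sum.inl fun k => Sum.inr (f (Sum.inl k)))
      fun j => Sum.inr (f (Sum.inr j)) : (ι ⊕ κ) ⊕ ℕ → ι ⊕ ℕ) =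
      Sum.elim (Sum.elim x fun k => y (f (Sum.inl k))) fun j => y (f (Sum.inr j)) := by
    intro y
    funext i
    rcases i with (i | k) | j <;> rfl
  constructor
  · rintro ⟨y, hy⟩
    exact ⟨_, _, by rw [key] at hy; exact hy⟩
  · rintro ⟨z, w, hzw⟩
    refine ⟨Function.extend f (Sum.elim z w) 0, ?_⟩
    rw [key]
    simpa only [hf.extend_apply, Sum.elim_inl, Sum.elim_inr] using hzw

variable [LinearOrder R] [IsStrictOrderedRing R]

/-- In an ordered ring two equations combine into one as a sum of squares, with separate copies of
the quantified variables. -/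
theorem IsDioph.inter {S T : Set (ι → R)} (hS : IsDioph S) (hT : IsDioph T) :
    IsDioph (S ∩ T) := by
  obtain ⟨h, rfl⟩ := hS
  obtain ⟨g, rfl⟩ := hT
  have := (isDioph_zeroLocus (R := R)
    (MvPolynomial.rename (Sum.map id Sum.inl : ι ⊕ ℕ → ι ⊕ (ℕ ⊕ ℕ)) h ^ 2 +
      MvPolynomial.rename (Sum.map id Sum.inr) g ^ 2)).exists
  convert this using 1
  ext x
  simp only [diophSet, Set.mem_inter_iff, Set.mem_ofPred_eq, map_add, map_pow,
    MvPolynomial.eval_rename]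
  constructor
  · rintro ⟨⟨y, hy⟩, z, hz⟩
    refine ⟨Sum.elim y z, ?_⟩
    simp [Sum.elim_comp_map, hy, hz]
  · rintro ⟨w, hw⟩
    rw [Sum.elim_comp_map, Sum.elim_comp_map, Function.comp_id,
      add_eq_zero_iff_of_nonneg (sq_nonneg _) (sq_nonneg _)] at hw
    exact ⟨⟨_, pow_eq_zero_iff two_ne_zero |>.1 hw.1⟩, _, pow_eq_zero_iff two_ne_zero |>.1 hw.2⟩

theorem isDioph_biInter {α : Type*} (F : Finset α) {S : α → Set (ι → R)}
    (hS : ∀ a ∈ F, IsDioph (S a)) : IsDioph {x | ∀ a ∈ F, x ∈ S a} := by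
  classical
  induction F using Finset.induction_on with
  | empty =>
    convert isDioph_zeroLocus (0 : MvPolynomial ι R) using 1
    simp
  | insert a F _ ih =>
    have := (hS a (Finset.mem_insert_self a F)).inter
      (ih fun b hb => hS b (Finset.mem_insert_of_mem hb))
    convert this using 1
    ext x
    simp

end Dioph

/-! ### Localizations of `ℤ` are diophantine in `ℚ` -/

/-- `S` consists of the `x` for which the norm-form equation is solvable. The alternative between
`n` and `n + 1` is there for `p = 2`, where only odd integers are known to be solutions. -/
theorem exists_isDioph_between {p : ℕ} (hp : p.Prime) :
    ∃ S : Set (Unit → ℚ), IsDioph S ∧ (∀ n : ℤ, (fun _ => (n : ℚ)) ∈ S ∨ (fun _ => (n + 1 : ℚ)) ∈ S) ∧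
      ∀ x ∈ S, ¬ p ∣ (x ()).den := by
  by_cases hp2 : p = 2
  · subst hp2
    refine ⟨_, (isDioph_zeroLocus (R := ℚ) (ι := Unit ⊕ Fin 3)
      (2 * (2 + (5 * MvPolynomial.X (Sum.inl ())) ^ 2) - (MvPolynomial.X (Sum.inr 0) ^ 2 -
        5 * MvPolynomial.X (Sum.inr 1) ^ 2 + 10 * MvPolynomial.X (Sum.inr 2) ^ 2))).exists, ?_, ?_⟩
    · have key : ∀ n : ℤ, n % 2 = 1 → ∃ y : Fin 3 → ℚ,
          2 * (2 + (5 * (n : ℚ)) ^ 2) - (y 0 ^ 2 - 5 * y 1 ^ 2 + 10 * y 2 ^ 2) = 0 := by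
        intro n hn
        obtain ⟨a, b, d, h⟩ := exists_repr_two (y := n.natAbs) (Nat.odd_iff.2 (by omega))
        refine ⟨![a, b, d], ?_⟩
        have : ((n.natAbs : ℕ) : ℚ) ^ 2 = n ^ 2 := by
          rw [Nat.cast_natAbs, Int.cast_abs, sq_abs]
        simp only [Matrix.cons_val]
        linear_combination h - 50 * this
      intro n
      rcases Int.emod_two_eq_zero_or_one n with h | h
      · right
        obtain ⟨y, hy⟩ := key (n + 1) (by omega)
        exact ⟨y, by simpa using hy⟩
      · left
        obtain ⟨y, hy⟩ := key n h
        exact ⟨y, by simpa using hy⟩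
    · rintro x ⟨y, hy⟩
      simp only [Set.mem_ofPred_eq, map_sub, map_mul, map_add, map_pow, MvPolynomial.eval_X,
        map_ofNat, Sum.elim_inl, Sum.elim_inr] at hy
      have := evenNormForm_two_five.not_dvd_den Nat.prime_two (x := 5 * x ()) (d := y 2)
        (a := y 0) (b := y 1) (by push_cast; linear_combination hy)
      intro h
      refine this ?_
      by_contra h5
      exact not_dvd_den_of_mul_eq (p := 2) (D := 5 * (5 * x ()).den) (N := (5 * x ()).num) (x := x ())
        (by omega) (by push_cast; rw [← Rat.mul_den_eq_num (5 * x ())]; ring) h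
  · obtain ⟨q, hq, hq4, hqp⟩ := exists_prime_one_mod_four_nonresidue hp hp2
    have := Fact.mk hp
    refine ⟨_, (isDioph_zeroLocus (R := ℚ) (ι := Unit ⊕ Fin 3)
      (1 + MvPolynomial.C (p : ℚ) * (MvPolynomial.C (2 * q : ℚ) * MvPolynomial.X (Sum.inl ())) ^ 2 -
        (MvPolynomial.X (Sum.inr 0) ^ 2 - MvPolynomial.C (q : ℚ) * MvPolynomial.X (Sum.inr 1) ^ 2 +
          MvPolynomial.C (p * q : ℚ) * MvPolynomial.X (Sum.inr 2) ^ 2))).exists,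
      fun n => Or.inl ?_, ?_⟩
    · obtain ⟨a, b, d, h⟩ := exists_repr_of_odd_prime hp hp2 hq hq4 n.natAbs
      refine ⟨![a, b, d], ?_⟩
      have : ((n.natAbs : ℕ) : ℚ) ^ 2 = n ^ 2 := by
        rw [Nat.cast_natAbs, Int.cast_abs, sq_abs]
      simp only [Set.mem_ofPred_eq, map_sub, map_mul, map_add, map_pow, map_one, MvPolynomial.eval_X,
        MvPolynomial.eval_C, Sum.elim_inl, Sum.elim_inr, Matrix.cons_val]
      linear_combination h - p * (2 * q) ^ 2 * this
    · rintro x ⟨y, hy⟩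
      simp only [Set.mem_ofPred_eq, map_sub, map_mul, map_add, map_pow, map_one, MvPolynomial.eval_X,
        MvPolynomial.eval_C, Sum.elim_inl, Sum.elim_inr] at hy
      have h1 := (evenNormForm_of_nonresidue hqp).not_dvd_den hp (x := 2 * q * x ()) (d := y 2)
        (a := y 0) (b := y 1) (by push_cast; linear_combination hy)
      have hpp := Nat.prime_iff_prime_int.1 hp
      have hp2' : ¬ (p : ℤ) ∣ 2 := fun h =>
        hp2 ((Nat.prime_dvd_prime_iff_eq hp Nat.prime_two).1 (by exact_mod_cast h))
      have hpq' : ¬ (p : ℤ) ∣ q := by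
        intro h
        have h0 := jacobiSym.mod_left (q : ℤ) p
        rw [Int.emod_eq_zero_of_dvd h, jacobiSym.zero_left hp.one_lt, hqp] at h0
        norm_num at h0
      refine not_dvd_den_of_mul_eq (D := 2 * q * (2 * q * x ()).den) (N := (2 * q * x ()).num) ?_
        (by push_cast; rw [← Rat.mul_den_eq_num (2 * q * x ())]; ring)
      intro h
      rcases hpp.dvd_or_dvd h with h | h
      · exact (hpp.dvd_or_dvd h).elim hp2' hpq'
      · exact h1 (by exact_mod_cast h)

theorem not_dvd_den_div {p : ℕ} (hp : p.Prime) {x m e : ℚ} (hm : ¬ p ∣ m.den) (he : ¬ p ∣ e.den)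
    (h : x * (1 + p * e) = m) : ¬ p ∣ x.den := by
  have hpp := Nat.prime_iff_prime_int.1 hp
  refine not_dvd_den_of_mul_eq (D := (e.den + p * e.num) * m.den) (N := m.num * e.den) ?_ ?_
  · intro hd
    rcases hpp.dvd_or_dvd hd with hd | hd
    · exact he (by exact_mod_cast (dvd_add_left (dvd_mul_right _ _)).1 hd)
    · exact hm (by exact_mod_cast hd)
  · push_cast
    rw [← Rat.mul_den_eq_num m, ← Rat.mul_den_eq_num e, ← h]
    ring

theorem exists_eq_div_one_add {p : ℕ} (hp : p.Prime) {x : ℚ} (hx : ¬ p ∣ x.den) :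
    ∃ m e : ℤ, x * (1 + p * e) = m := by
  have hc : IsCoprime (x.den : ℤ) p :=
    Nat.isCoprime_iff_coprime.2 (((Nat.Prime.coprime_iff_not_dvd hp).2 hx).symm)
  obtain ⟨u, v, huv⟩ := hc
  refine ⟨x.num * u, -v, ?_⟩
  have : (1 + p * ((-v : ℤ) : ℚ)) = u * x.den := by
    have : (u : ℚ) * x.den + v * p = 1 := by exact_mod_cast huv
    push_cast; linarith
  rw [this]
  push_cast
  rw [← Rat.mul_den_eq_num x]; ring

theorem not_dvd_den_of_add {p : ℕ} {x t : ℚ} (ht : t = 0 ∨ t = 1) (h : ¬ p ∣ (x + t).den) :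
    ¬ p ∣ x.den := by
  rcases ht with rfl | rfl
  · simpa using h
  · refine not_dvd_den_of_mul_eq (D := (x + 1).den) (N := (x + 1).num - (x + 1).den)
      (by exact_mod_cast h) ?_
    push_cast
    rw [← Rat.mul_den_eq_num (x + 1)]; ring

/-- The localization of `ℤ` at a prime is diophantine in `ℚ`. -/
theorem isDioph_localization {p : ℕ} (hp : p.Prime) :
    IsDioph {x : Unit → ℚ | ¬ p ∣ (x ()).den} := by
  obtain ⟨S, hS, hint, hsub⟩ := exists_isDioph_between hp
  -- An element of `ℤ_(p)` is a quotient `m / (1 + p e)` of integers. Replacing "integer" by "in `S`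
  -- after adding `0` or `1`" keeps `m` and `e` `p`-integral, so the denominator stays a `p`-adic
  -- unit.
  have d1 := isDioph_zeroLocus (R := ℚ) (ι := Unit ⊕ Fin 4)
    (MvPolynomial.X (Sum.inl ()) * (1 + MvPolynomial.C (p : ℚ) * MvPolynomial.X (Sum.inr 1)) -
      MvPolynomial.X (Sum.inr 0))
  have d2 := isDioph_zeroLocus (R := ℚ) (ι := Unit ⊕ Fin 4)
    (MvPolynomial.X (Sum.inr 2) * (MvPolynomial.X (Sum.inr 2) - 1))
  have d3 := isDioph_zeroLocus (R := ℚ) (ι := Unit ⊕ Fin 4)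
    (MvPolynomial.X (Sum.inr 3) * (MvPolynomial.X (Sum.inr 3) - 1))
  have d4 := hS.preimage (ι := Unit ⊕ Fin 4)
    fun _ => MvPolynomial.X (Sum.inr 0) + MvPolynomial.X (Sum.inr 2)
  have d5 := hS.preimage (ι := Unit ⊕ Fin 4)
    fun _ => MvPolynomial.X (Sum.inr 1) + MvPolynomial.X (Sum.inr 3)
  convert (d1.inter (d2.inter (d3.inter (d4.inter d5)))).exists using 1
  ext x
  simp only [Set.mem_ofPred_eq, Set.mem_inter_iff, map_sub, map_mul, map_add, map_one,
    MvPolynomial.eval_X, MvPolynomial.eval_C, Sum.elim_inl, Sum.elim_inr]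
  constructor
  · intro hx
    obtain ⟨m, e, hme⟩ := exists_eq_div_one_add hp hx
    have key : ∀ n : ℤ, ∃ t : ℚ, t * (t - 1) = 0 ∧ (fun _ => (n + t : ℚ)) ∈ S := fun n =>
      (hint n).elim (fun h => ⟨0, by simp, by simpa using h⟩) fun h => ⟨1, by simp, h⟩
    obtain ⟨t, ht, ht'⟩ := key m
    obtain ⟨s, hs, hs'⟩ := key e
    refine ⟨![m, e, t, s], ?_⟩
    simp only [Matrix.cons_val]
    exact ⟨by rw [hme, sub_self], ht, hs, ht', hs'⟩
  · rintro ⟨y, h1, h2, h3, h4, h5⟩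
    have aux : ∀ t : ℚ, t * (t - 1) = 0 → t = 0 ∨ t = 1 := fun t ht =>
      (mul_eq_zero.1 ht).imp id sub_eq_zero.1
    exact not_dvd_den_div hp (not_dvd_den_of_add (aux _ h2) (hsub _ h4))
      (not_dvd_den_of_add (aux _ h3) (hsub _ h5)) (sub_eq_zero.1 h1)

/-! ### Models in subrings of `ℚ`, viewed inside `ℚ` -/

section Rational

variable {ι : Type*}

theorem coe_aeval_subring (R : Subring ℚ) (s : ι → R) (f : MvPolynomial ι ℤ) :
    ((MvPolynomial.aeval s f : R) : ℚ) = MvPolynomial.aeval (fun i => (s i : ℚ)) f :=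
  MvPolynomial.comp_aeval_apply s R.subtype.toIntAlgHom f

/-- The subset of `R^ι` defined by `h`, for a subring `R` of `ℚ`, viewed as a subset of `ℚ^ι`. -/
def ratSolutions (R : Subring ℚ) (h : MvPolynomial (ι ⊕ ℕ) ℤ) : Set (ι → ℚ) :=
  {x | (∀ i, x i ∈ R) ∧ ∃ y : ℕ → ℚ, (∀ j, y j ∈ R) ∧ MvPolynomial.aeval (Sum.elim x y) h = 0}

theorem coe_mem_ratSolutions {R : Subring ℚ} {h : MvPolynomial (ι ⊕ ℕ) ℤ} {x : ι → R} :
    (fun i => (x i : ℚ)) ∈ ratSolutions R h ↔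
      x ∈ diophSet (MvPolynomial.map (Int.castRingHom R) h) := by
  have key : ∀ y : ℕ → R, MvPolynomial.eval (Sum.elim x y) (MvPolynomial.map (Int.castRingHom R) h) = 0
      ↔ MvPolynomial.aeval (Sum.elim (fun i => (x i : ℚ)) fun j => (y j : ℚ)) h = 0 := by
    intro y
    have h1 : MvPolynomial.eval (Sum.elim x y) (MvPolynomial.map (Int.castRingHom R) h) =
        MvPolynomial.aeval (Sum.elim x y) h := by
      rw [MvPolynomial.eval_map, MvPolynomial.aeval_def]; rfl
    have h2 : (Sum.elim (fun i => (x i : ℚ)) fun j => (y j : ℚ)) =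
        fun k => ((Sum.elim x y k : R) : ℚ) := by
      funext k; rcases k with k | k <;> rfl
    rw [h1, h2, ← coe_aeval_subring, ZeroMemClass.coe_eq_zero]
  constructor
  · rintro ⟨-, y, hy, h0⟩
    exact ⟨fun j => ⟨y j, hy j⟩, (key _).2 h0⟩
  · rintro ⟨y, hy⟩
    exact ⟨fun i => (x i).2, fun j => y j, fun j => (y j).2, (key y).1 hy⟩

theorem exists_lift_of_forall_mem {R : Subring ℚ} {x : ι → ℚ} (hx : ∀ i, x i ∈ R) :
    ∃ x' : ι → R, x = fun i => (x' i : ℚ) := ⟨fun i => ⟨x i, hx i⟩, rfl⟩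

end Rational

section ModelMap

variable {R : Type*} [CommRing R] {n : ℕ}

/-- `e` is an isomorphism from `ℤ` to `D` with the operations with graphs `A` and `M`. -/
structure IsModelMap (e : ℤ → Fin n → R) (D : Set (Fin n → R))
    (A M : Set (Fin 3 × Fin n → R)) : Prop where
  injective : Function.Injective e
  range_eq : Set.range e = D
  add_iff : ∀ x₁ x₂ x₃, concat3 x₁ x₂ x₃ ∈ A ↔
    ∃ a b : ℤ, x₁ = e a ∧ x₂ = e b ∧ x₃ = e (a + b)
  mul_iff : ∀ x₁ x₂ x₃, concat3 x₁ x₂ x₃ ∈ M ↔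
    ∃ a b : ℤ, x₁ = e a ∧ x₂ = e b ∧ x₃ = e (a * b)

theorem isDiophantineModel_iff {h : MvPolynomial (Fin n ⊕ ℕ) R}
    {hadd hmul : MvPolynomial ((Fin 3 × Fin n) ⊕ ℕ) R} :
    IsDiophantineModel h hadd hmul ↔
      ∃ e : ℤ → Fin n → R, IsModelMap e (diophSet h) (diophSet hadd) (diophSet hmul) := by
  constructor
  · rintro ⟨e, he⟩
    refine ⟨fun k => e k, Subtype.val_injective.comp e.injective, ?_, fun _ _ _ => (he _ _ _).1,
      fun _ _ _ => (he _ _ _).2⟩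
    ext x
    constructor
    · rintro ⟨k, rfl⟩; exact (e k).2
    · intro hx; exact ⟨e.symm ⟨x, hx⟩, by simp⟩
  · rintro ⟨e, he⟩
    refine ⟨(Equiv.ofInjective e he.injective).trans (Equiv.setCongr he.range_eq),
      fun x₁ x₂ x₃ => ⟨he.add_iff x₁ x₂ x₃, he.mul_iff x₁ x₂ x₃⟩⟩

/-- Letting the isomorphism take values in `ℚ^n` makes models in different rings `R_W` comparable.
-/
theorem admitsVia_iff {R : Subring ℚ} {h : MvPolynomial (Fin n ⊕ ℕ) ℤ}
    {hadd hmul : MvPolynomial ((Fin 3 × Fin n) ⊕ ℕ) ℤ} :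
    AdmitsDiophantineModelVia R h hadd hmul ↔
      ∃ e : ℤ → Fin n → ℚ,
        IsModelMap e (ratSolutions R h) (ratSolutions R hadd) (ratSolutions R hmul) := by
  rw [AdmitsDiophantineModelVia, isDiophantineModel_iff]
  have hc : ∀ x₁ x₂ x₃ : Fin n → R,
      concat3 (fun i => (x₁ i : ℚ)) (fun i => (x₂ i : ℚ)) (fun i => (x₃ i : ℚ)) =
        fun ij => ((concat3 x₁ x₂ x₃ ij : R) : ℚ) := by
    intro x₁ x₂ x₃
    funext ⟨i, j⟩
    fin_cases i <;> rfl
  have hinj : ∀ {x y : Fin n → R}, (fun i => (x i : ℚ)) = (fun i => (y i : ℚ)) ↔ x = y := by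
    intro x y
    refine ⟨fun h => funext fun i => Subtype.ext (congrFun h i), fun h => by rw [h]⟩
  constructor
  · rintro ⟨e, he⟩
    have graph : ∀ (g : MvPolynomial ((Fin 3 × Fin n) ⊕ ℕ) ℤ) (op : ℤ → ℤ → ℤ),
        (∀ x₁ x₂ x₃, concat3 x₁ x₂ x₃ ∈ diophSet (MvPolynomial.map (Int.castRingHom R) g) ↔
          ∃ a b : ℤ, x₁ = e a ∧ x₂ = e b ∧ x₃ = e (op a b)) →
        ∀ x₁ x₂ x₃ : Fin n → ℚ, concat3 x₁ x₂ x₃ ∈ ratSolutions R g ↔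
          ∃ a b : ℤ, x₁ = (fun i => (e a i : ℚ)) ∧ x₂ = (fun i => (e b i : ℚ)) ∧
            x₃ = (fun i => (e (op a b) i : ℚ)) := by
      intro g op hg x₁ x₂ x₃
      constructor
      · intro hx
        obtain ⟨x₁, rfl⟩ := exists_lift_of_forall_mem (x := x₁) fun i => hx.1 (0, i)
        obtain ⟨x₂, rfl⟩ := exists_lift_of_forall_mem (x := x₂) fun i => hx.1 (1, i)
        obtain ⟨x₃, rfl⟩ := exists_lift_of_forall_mem (x := x₃) fun i => hx.1 (2, i)
        simp only [hinj, ← hg]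
        rw [← coe_mem_ratSolutions, ← hc]
        exact hx
      · rintro ⟨a, b, rfl, rfl, rfl⟩
        rw [hc, coe_mem_ratSolutions, hg]
        exact ⟨a, b, rfl, rfl, rfl⟩
    refine ⟨fun k i => e k i, fun a b hab => he.injective (hinj.1 hab), ?_,
      graph _ _ he.add_iff, graph _ _ he.mul_iff⟩
    ext x
    constructor
    · rintro ⟨k, rfl⟩
      rw [coe_mem_ratSolutions, ← he.range_eq]
      exact ⟨k, rfl⟩
    · intro hx
      obtain ⟨x, rfl⟩ := exists_lift_of_forall_mem hx.1
      rw [coe_mem_ratSolutions, ← he.range_eq] at hx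
      obtain ⟨k, rfl⟩ := hx
      exact ⟨k, rfl⟩
  · rintro ⟨e, he⟩
    have hmem : ∀ k i, e k i ∈ R := fun k =>
      (show e k ∈ ratSolutions R h by rw [← he.range_eq]; exact ⟨k, rfl⟩).1
    choose e' he' using fun k => exists_lift_of_forall_mem (hmem k)
    obtain rfl : e = fun k i => (e' k i : ℚ) := funext he'
    refine ⟨e', fun a b hab => he.injective (by simp only [hab]), ?_, fun x₁ x₂ x₃ => ?_,
      fun x₁ x₂ x₃ => ?_⟩
    · ext x
      rw [← coe_mem_ratSolutions, ← he.range_eq]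
      simp only [Set.mem_range, hinj]
    · rw [← coe_mem_ratSolutions, ← hc, he.add_iff]
      simp only [hinj]
    · rw [← coe_mem_ratSolutions, ← hc, he.mul_iff]
      simp only [hinj]

end ModelMap

/-! ### Integer coefficients and transfer of models to `ℚ` -/

section ClearDenominators

variable {R : Type*} [CommRing R]

theorem exists_int_polynomial {σ : Type*} (hR : ∀ r : R, ∃ N : ℤ, N ≠ 0 ∧ ∃ m : ℤ, N * r = m)
    (h : MvPolynomial σ R) : ∃ N : ℤ, N ≠ 0 ∧ ∃ g : MvPolynomial σ ℤ,
      MvPolynomial.map (Int.castRingHom R) g = MvPolynomial.C (N : R) * h := by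
  induction h using MvPolynomial.induction_on with
  | C a =>
    obtain ⟨N, hN, m, hm⟩ := hR a
    refine ⟨N, hN, MvPolynomial.C m, ?_⟩
    rw [MvPolynomial.map_C, ← MvPolynomial.C_mul, hm]; simp
  | add p q hp hq =>
    obtain ⟨N, hN, g, hg⟩ := hp
    obtain ⟨N', hN', g', hg'⟩ := hq
    refine ⟨N * N', mul_ne_zero hN hN', MvPolynomial.C N' * g + MvPolynomial.C N * g', ?_⟩
    rw [map_add, map_mul, map_mul, hg, hg', MvPolynomial.map_C, MvPolynomial.map_C]
    simp only [eq_intCast, Int.cast_mul, MvPolynomial.C_mul]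
    ring
  | mul_X p i hp =>
    obtain ⟨N, hN, g, hg⟩ := hp
    exact ⟨N, hN, g * MvPolynomial.X i, by rw [map_mul, hg, MvPolynomial.map_X, mul_assoc]⟩

theorem exists_int_polynomial_diophSet [IsDomain R] [CharZero R] {ι : Type*}
    (hR : ∀ r : R, ∃ N : ℤ, N ≠ 0 ∧ ∃ m : ℤ, N * r = m) (h : MvPolynomial (ι ⊕ ℕ) R) :
    ∃ g : MvPolynomial (ι ⊕ ℕ) ℤ, diophSet (MvPolynomial.map (Int.castRingHom R) g) = diophSet h := by
  obtain ⟨N, hN, g, hg⟩ := exists_int_polynomial hR h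
  refine ⟨g, Set.ext fun x => exists_congr fun y => ?_⟩
  rw [hg, map_mul, MvPolynomial.eval_C, mul_eq_zero, or_iff_right]
  exact_mod_cast hN

theorem admits_iff_exists_via [IsDomain R] [CharZero R]
    (hR : ∀ r : R, ∃ N : ℤ, N ≠ 0 ∧ ∃ m : ℤ, N * r = m) :
    AdmitsDiophantineModel R ↔ ∃ (n : ℕ) (h : MvPolynomial (Fin n ⊕ ℕ) ℤ)
      (hadd hmul : MvPolynomial ((Fin 3 × Fin n) ⊕ ℕ) ℤ), AdmitsDiophantineModelVia R h hadd hmul := by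
  constructor
  · rintro ⟨n, h, hadd, hmul, hm⟩
    obtain ⟨g, hg⟩ := exists_int_polynomial_diophSet hR h
    obtain ⟨gadd, hgadd⟩ := exists_int_polynomial_diophSet hR hadd
    obtain ⟨gmul, hgmul⟩ := exists_int_polynomial_diophSet hR hmul
    refine ⟨n, g, gadd, gmul, ?_⟩
    rw [AdmitsDiophantineModelVia, isDiophantineModel_iff, hg, hgadd, hgmul]
    exact isDiophantineModel_iff.1 hm
  · rintro ⟨n, h, hadd, hmul, hm⟩
    exact ⟨n, _, _, _, hm⟩

theorem Rat.exists_int_mul_eq (r : ℚ) : ∃ N : ℤ, N ≠ 0 ∧ ∃ m : ℤ, N * r = m :=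
  ⟨r.den, by exact_mod_cast r.den_nz, r.num, by rw [mul_comm]; exact_mod_cast Rat.mul_den_eq_num r⟩

theorem Subring.exists_int_mul_eq (R : Subring ℚ) (r : R) :
    ∃ N : ℤ, N ≠ 0 ∧ ∃ m : ℤ, N * r = m := by
  obtain ⟨N, hN, m, hm⟩ := Rat.exists_int_mul_eq r
  exact ⟨N, hN, m, Subtype.ext (by simpa using hm)⟩

end ClearDenominators

theorem ratSolutions_top {ι : Type*} (h : MvPolynomial (ι ⊕ ℕ) ℤ) :
    ratSolutions ⊤ h = diophSet (MvPolynomial.map (Int.castRingHom ℚ) h) := by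
  ext x
  simp only [ratSolutions, diophSet, Subring.mem_top, implies_true, true_and, Set.mem_ofPred_eq,
    MvPolynomial.eval_map, MvPolynomial.aeval_def]
  rfl

theorem admits_top_iff : AdmitsDiophantineModel (⊤ : Subring ℚ) ↔ AdmitsDiophantineModel ℚ := by
  rw [admits_iff_exists_via (Subring.exists_int_mul_eq ⊤), admits_iff_exists_via Rat.exists_int_mul_eq]
  refine exists_congr fun n => exists_congr fun h => exists_congr fun hadd => exists_congr fun hmul => ?_
  rw [admitsVia_iff, AdmitsDiophantineModelVia, isDiophantineModel_iff]
  simp only [ratSolutions_top]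

theorem isDioph_ratSolutions {R : Subring ℚ} (hR : IsDioph {x : Unit → ℚ | x () ∈ R}) {ι : Type*}
    [Fintype ι] (h : MvPolynomial (ι ⊕ ℕ) ℤ) : IsDioph (ratSolutions R h) := by
  classical
  have h1 : ∀ k : ι ⊕ ℕ, IsDioph {z : ι ⊕ ℕ → ℚ | z k ∈ R} := fun k => by
    simpa using hR.preimage fun _ => MvPolynomial.X k
  have h2 := ((isDioph_biInter Finset.univ fun (i : ι) _ => h1 (Sum.inl i)).inter
    ((isDioph_biInter h.vars fun k _ => h1 k).inter
      (isDioph_zeroLocus (MvPolynomial.map (Int.castRingHom ℚ) h)))).exists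
  convert h2 using 1
  ext x
  simp only [ratSolutions, Set.mem_ofPred_eq, Set.mem_inter_iff, Sum.elim_inl, Finset.mem_univ,
    true_implies, MvPolynomial.eval_map]
  constructor
  · rintro ⟨hx, y, hy, h0⟩
    exact ⟨y, hx, fun k _ => by rcases k with k | k; exacts [hx k, hy k], h0⟩
  · rintro ⟨y, hx, hy, h0⟩
    -- Only the finitely many variables occurring in `h` are constrained to `R`; the others may be
    -- reset to `0`.
    refine ⟨hx, fun j => if y j ∈ R then y j else 0, fun j => ?_, ?_⟩
    · dsimp only
      split_ifs with hj
      exacts [hj, R.zero_mem]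
    · rw [← h0]
      refine MvPolynomial.eval₂Hom_congr' rfl (fun k hk _ => ?_) rfl
      rcases k with k | k
      · rfl
      · simpa using fun hk' => absurd (hy _ hk) hk'

theorem admits_rat_of_isDioph {R : Subring ℚ} (hR : IsDioph {x : Unit → ℚ | x () ∈ R})
    (h : AdmitsDiophantineModel R) : AdmitsDiophantineModel ℚ := by
  obtain ⟨n, h, hadd, hmul, hm⟩ := (admits_iff_exists_via (Subring.exists_int_mul_eq R)).1 h
  obtain ⟨e, he⟩ := admitsVia_iff.1 hm
  obtain ⟨g, hg⟩ := isDioph_ratSolutions hR h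
  obtain ⟨gadd, hgadd⟩ := isDioph_ratSolutions hR hadd
  obtain ⟨gmul, hgmul⟩ := isDioph_ratSolutions hR hmul
  rw [← hg, ← hgadd, ← hgmul] at he
  exact ⟨n, g, gadd, gmul, isDiophantineModel_iff.2 ⟨e, he⟩⟩

/-! ### The rings `R_W` and the topology of `𝒜(f)` -/

theorem mem_ringOf_iff {W : PrimeSet} {x : ℚ} :
    x ∈ ringOf W ↔ ∀ p : Nat.Primes, (p : ℕ) ∣ x.den → W p = true := by
  constructor
  · intro hx
    induction hx using Subring.closure_induction with
    | mem x hx =>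
      obtain ⟨q, hq, rfl⟩ := hx
      intro p hp
      have h1 : (1 / ((q : ℕ) : ℚ)).den = q := by
        rw [one_div, Rat.inv_natCast_den_of_pos q.2.pos]
      rw [h1, Nat.prime_dvd_prime_iff_eq p.2 q.2] at hp
      rwa [Subtype.ext hp]
    | zero => intro p hp; exact absurd (Nat.dvd_one.1 hp) p.2.ne_one
    | one => intro p hp; exact absurd (Nat.dvd_one.1 hp) p.2.ne_one
    | add x y _ _ hx hy =>
      intro p hp
      exact (p.2.dvd_mul.1 (hp.trans (Rat.add_den_dvd x y))).elim (hx p) (hy p)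
    | neg x _ hx => intro p hp; exact hx p (by simpa using hp)
    | mul x y _ _ hx hy =>
      intro p hp
      exact (p.2.dvd_mul.1 (hp.trans (Rat.mul_den_dvd x y))).elim (hx p) (hy p)
  · intro h
    have key : ∀ n : ℕ, n ≠ 0 → (∀ p : Nat.Primes, (p : ℕ) ∣ n → W p = true) →
        (1 / (n : ℚ)) ∈ ringOf W := by
      intro n
      induction n using induction_on_primes with
      | zero => intro h; exact absurd rfl h
      | one => intro _ _; simp
      | prime_mul p n hp ih =>
        intro h0 h
        rw [Nat.cast_mul, ← one_div_mul_one_div]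
        refine (ringOf W).mul_mem (Subring.subset_closure ⟨⟨p, hp⟩, h _ (dvd_mul_right _ _), rfl⟩)
          (ih (right_ne_zero_of_mul h0) fun q hq => h q (hq.mul_left _))
    have hx : x = x.num * (1 / (x.den : ℚ)) := by
      rw [mul_one_div, Rat.num_div_den]
    rw [hx]
    exact (ringOf W).mul_mem (intCast_mem (ringOf W) _) (key _ x.den_nz h)

theorem ringOf_true : ringOf (fun _ => true) = ⊤ :=
  eq_top_iff.2 fun _ _ => mem_ringOf_iff.2 fun _ _ => rfl

theorem ringOf_mono {W W' : PrimeSet} (h : W ≤ W') : ringOf W ≤ ringOf W' := fun _ hx =>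
  mem_ringOf_iff.2 fun p hp => Bool.eq_true_of_true_le ((mem_ringOf_iff.1 hx p hp) ▸ h p)

theorem isOpen_setOf_apply_eq (p : Nat.Primes) (b : Bool) : IsOpen {W : PrimeSet | W p = b} := by
  have h : Continuous fun W : PrimeSet => W p := continuous_apply p
  exact (isOpen_discrete ({b} : Set Bool)).preimage h

theorem isOpen_setOf_mem_ringOf (x : ℚ) : IsOpen {W | x ∈ ringOf W} := by
  have : {W | x ∈ ringOf W} = ⋂ p ∈ {p : Nat.Primes | (p : ℕ) ∣ x.den}, {W : PrimeSet | W p = true} := by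
    ext W
    simp [mem_ringOf_iff]
  rw [this]
  refine Set.Finite.isOpen_biInter ?_ fun p _ => isOpen_setOf_apply_eq p true
  have hf : {n : ℕ | n ∣ x.den}.Finite :=
    (Set.finite_le_nat x.den).subset fun n hn => Nat.le_of_dvd x.den_pos hn
  have h := hf.preimage (f := fun p : Nat.Primes => (p : ℕ)) Nat.Primes.coe_nat_injective.injOn
  exact h

theorem mem_solvableSet_iff {f : MvPolynomial ℕ ℤ} {W : PrimeSet} :
    W ∈ solvableSet f ↔
      ∃ r : ℕ → ℚ, (∀ i ∈ f.vars, r i ∈ ringOf W) ∧ MvPolynomial.aeval r f = 0 := by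
  constructor
  · rintro ⟨r, hr⟩
    refine ⟨fun i => r i, fun i _ => (r i).2, ?_⟩
    rw [← coe_aeval_subring, hr, ZeroMemClass.coe_zero]
  · rintro ⟨r, hr, h0⟩
    classical
    refine ⟨fun i => if h : r i ∈ ringOf W then ⟨r i, h⟩ else 0, ?_⟩
    rw [← ZeroMemClass.coe_eq_zero, coe_aeval_subring, ← h0]
    refine MvPolynomial.eval₂Hom_congr' rfl (fun i hi _ => ?_) rfl
    simp [hr i hi]

theorem isOpen_solvableSet (f : MvPolynomial ℕ ℤ) : IsOpen (solvableSet f) := by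
  have : solvableSet f = ⋃ r ∈ {r : ℕ → ℚ | MvPolynomial.aeval r f = 0},
      ⋂ i ∈ f.vars, {W | r i ∈ ringOf W} := by
    ext W
    simp only [mem_solvableSet_iff, Set.mem_iUnion, Set.mem_iInter, Set.mem_ofPred_eq, exists_prop]
    exact exists_congr fun r => and_comm
  rw [this]
  exact isOpen_biUnion fun r _ => isOpen_biInter_finset fun i _ => isOpen_setOf_mem_ringOf _

theorem solvableSet_mono {f : MvPolynomial ℕ ℤ} {W W' : PrimeSet} (h : W ≤ W')
    (hW : W ∈ solvableSet f) : W' ∈ solvableSet f := by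
  rw [mem_solvableSet_iff] at *
  obtain ⟨r, hr, h0⟩ := hW
  exact ⟨r, fun i hi => ringOf_mono h (hr i hi), h0⟩

/-- The condition that a fixed rational tuple satisfies a fixed diophantine condition over `R_W` is
of the form `W ∈ 𝒜(f)`. -/
theorem exists_solvableSet_eq {ι : Type*} [Fintype ι] (h : MvPolynomial (ι ⊕ ℕ) ℤ) (x : ι → ℚ) :
    ∃ f : MvPolynomial ℕ ℤ, solvableSet f = {W | x ∈ ratSolutions (ringOf W) h} := by
  have hcount : Countable ι := Finite.to_countable
  obtain ⟨k, hk⟩ := exists_injective_nat (ι ⊕ ℕ)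
  -- The added squares force the parameters to equal the rational tuple `x`, using integer
  -- coefficients only.
  set g : MvPolynomial (ι ⊕ ℕ) ℤ := h ^ 2 + ∑ i, (((x i).den : MvPolynomial (ι ⊕ ℕ) ℤ) *
    MvPolynomial.X (Sum.inl i) - ((x i).num : MvPolynomial (ι ⊕ ℕ) ℤ)) ^ 2 with hg
  have hg0 : ∀ z : ι ⊕ ℕ → ℚ, MvPolynomial.aeval z g = 0 ↔
      MvPolynomial.aeval z h = 0 ∧ ∀ i, z (Sum.inl i) = x i := by
    intro z
    rw [hg, map_add, map_pow, map_sum,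
      add_eq_zero_iff_of_nonneg (sq_nonneg _) (Finset.sum_nonneg fun i _ => by
        rw [map_pow]; exact sq_nonneg _),
      pow_eq_zero_iff two_ne_zero, Finset.sum_eq_zero_iff_of_nonneg fun i _ => by
        rw [map_pow]; exact sq_nonneg _]
    refine and_congr_right fun _ => ⟨fun h i => ?_, fun h i _ => ?_⟩
    · have := h i (Finset.mem_univ i)
      rw [map_pow, pow_eq_zero_iff two_ne_zero] at this
      simp only [map_sub, map_mul, map_natCast, map_intCast, MvPolynomial.aeval_X] at this
      have hd : ((x i).den : ℚ) ≠ 0 := by exact_mod_cast (x i).den_nz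
      apply mul_left_cancel₀ hd
      rw [sub_eq_zero.1 this, ← Rat.mul_den_eq_num, mul_comm]
    · rw [map_pow, pow_eq_zero_iff two_ne_zero]
      simp only [map_sub, map_mul, map_natCast, map_intCast, MvPolynomial.aeval_X]
      rw [h i, ← Rat.mul_den_eq_num, mul_comm, sub_self]
  refine ⟨MvPolynomial.rename k g, Set.ext fun W => ?_⟩
  constructor
  · rintro ⟨r, hr⟩
    rw [← ZeroMemClass.coe_eq_zero, coe_aeval_subring, MvPolynomial.aeval_rename, hg0] at hr
    refine ⟨fun i => ?_, fun j => r (k (Sum.inr j)), fun j => (r _).2, ?_⟩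
    · rw [← hr.2 i]; exact (r _).2
    · rw [← hr.1]
      congr 2
      funext i
      rcases i with i | j
      · exact (hr.2 i).symm
      · rfl
  · rintro ⟨hx, y, hy, h0⟩
    rw [mem_solvableSet_iff]
    refine ⟨Function.extend k (Sum.elim x y) 0, fun i _ => ?_, ?_⟩
    · by_cases hi : ∃ a, k a = i
      · obtain ⟨a, rfl⟩ := hi
        rw [hk.extend_apply]
        rcases a with a | a
        exacts [hx a, hy a]
      · rw [Function.extend_apply' _ _ _ hi]; exact (ringOf W).zero_mem
    · have hext : Function.extend k (Sum.elim x y) 0 ∘ k = Sum.elim x y :=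
        funext fun a => hk.extend_apply _ _ a
      rw [MvPolynomial.aeval_rename, hext, hg0]
      exact ⟨h0, fun i => rfl⟩

section Facts

variable {ι : Type*} [Fintype ι] (h : MvPolynomial (ι ⊕ ℕ) ℤ) (x : ι → ℚ)

theorem isOpen_setOf_mem_ratSolutions : IsOpen {W | x ∈ ratSolutions (ringOf W) h} := by
  obtain ⟨f, hf⟩ := exists_solvableSet_eq h x
  exact hf ▸ isOpen_solvableSet f

variable {h x}

theorem mem_ratSolutions_mono {W W' : PrimeSet} (hW : W ≤ W')
    (hx : x ∈ ratSolutions (ringOf W) h) : x ∈ ratSolutions (ringOf W') h := by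
  obtain ⟨f, hf⟩ := exists_solvableSet_eq h x
  have h1 : W ∈ solvableSet f := by rw [hf]; exact hx
  have h2 := solvableSet_mono hW h1
  rw [hf] at h2
  exact h2

theorem IsHTPGeneric.mem_ratSolutions {V : PrimeSet} (hV : IsHTPGeneric V)
    (hx : V ∈ closure {W | x ∈ ratSolutions (ringOf W) h}) : x ∈ ratSolutions (ringOf V) h := by
  obtain ⟨f, hf⟩ := exists_solvableSet_eq h x
  rw [← hf] at hx
  by_contra hn
  have hn' : V ∉ solvableSet f := by rw [hf]; exact hn
  refine hV f ?_
  rw [(isOpen_solvableSet f).frontier_eq]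
  exact ⟨hx, hn'⟩

end Facts

/-! ### Largest elements of the basic open sets -/

theorem nthPrime_surjective : Function.Surjective nthPrime := by
  intro p
  obtain ⟨i, hi⟩ := Set.mem_range.1 (show (p : ℕ) ∈ Set.range (Nat.nth Nat.Prime) by
    rw [Nat.range_nth_of_infinite Nat.infinite_setOfPred_prime]; exact p.2)
  exact ⟨i, Subtype.ext hi⟩

theorem nthPrime_injective : Function.Injective nthPrime := fun _ _ hij =>
  Nat.nth_injective Nat.infinite_setOfPred_prime (congrArg Subtype.val hij)

theorem isOpen_basicOpen (σ : List Bool) : IsOpen (basicOpen σ) := by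
  have : basicOpen σ = ⋂ i : Fin σ.length, {W : PrimeSet | W (nthPrime i) = σ[i]} := by
    ext W
    simp only [basicOpen, Set.mem_ofPred_eq, Set.mem_iInter]
    exact ⟨fun h i => h i i.2, fun h i hi => h ⟨i, hi⟩⟩
  rw [this]
  exact isOpen_iInter_of_finite fun i => isOpen_setOf_apply_eq _ _

/-- The largest element of `𝒰_σ`. -/
noncomputable def maxExtension (σ : List Bool) : PrimeSet := fun p =>
  σ.getD (Function.surjInv nthPrime_surjective p) true

theorem maxExtension_nthPrime (σ : List Bool) (i : ℕ) :
    maxExtension σ (nthPrime i) = σ.getD i true := by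
  rw [maxExtension, nthPrime_injective (Function.surjInv_eq nthPrime_surjective (nthPrime i))]

theorem maxExtension_mem (σ : List Bool) : maxExtension σ ∈ basicOpen σ := fun i hi => by
  rw [maxExtension_nthPrime]; simp [hi]

theorem le_maxExtension {σ : List Bool} {W : PrimeSet} (hW : W ∈ basicOpen σ) :
    W ≤ maxExtension σ := by
  intro p
  obtain ⟨i, rfl⟩ := nthPrime_surjective p
  rw [maxExtension_nthPrime]
  by_cases hi : i < σ.length
  · rw [hW i hi]; simp [hi]
  · rw [List.getD_eq_default _ _ (not_lt.1 hi)]; exact Bool.le_true _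

/-- If the largest element of `𝒰_σ` is a limit of `𝒜(f)`, then some `W` in `𝒰_σ` lies in `𝒜(f)`, and
upward closure puts the largest element in it too. -/
theorem isHTPGeneric_maxExtension (σ : List Bool) : IsHTPGeneric (maxExtension σ) := by
  intro f hf
  rw [(isOpen_solvableSet f).frontier_eq] at hf
  obtain ⟨W, hW, hWf⟩ := mem_closure_iff.1 hf.1 _ (isOpen_basicOpen σ) (maxExtension_mem σ)
  exact hf.2 (solvableSet_mono (le_maxExtension hW) hWf)

/-- Only the finitely many primes excluded by `σ` impose a condition, so the ring is a finite
intersection of localizations. -/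
theorem isDioph_ringOf_maxExtension (σ : List Bool) :
    IsDioph {x : Unit → ℚ | x () ∈ ringOf (maxExtension σ)} := by
  have := isDioph_biInter ((Finset.range σ.length).filter fun i => σ.getD i true = false)
    fun i _ => isDioph_localization (nthPrime i).2
  convert this using 1
  ext x
  simp only [Set.mem_ofPred_eq, mem_ringOf_iff, Finset.mem_filter, Finset.mem_range]
  constructor
  · intro h i hi hd
    have := h _ hd
    rw [maxExtension_nthPrime, hi.2] at this
    exact Bool.false_ne_true this
  · intro h p hp
    obtain ⟨i, rfl⟩ := nthPrime_surjective p
    rw [maxExtension_nthPrime]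
    by_contra hn
    rw [Bool.not_eq_true] at hn
    refine h i ⟨?_, hn⟩ hp
    by_contra hi
    rw [List.getD_eq_default _ _ (not_lt.1 hi)] at hn
    exact Bool.false_ne_true hn.symm

theorem AdmitsDiophantineModelVia.admits {R : Type*} [CommRing R] {n : ℕ}
    {h : MvPolynomial (Fin n ⊕ ℕ) ℤ} {hadd hmul : MvPolynomial ((Fin 3 × Fin n) ⊕ ℕ) ℤ}
    (H : AdmitsDiophantineModelVia R h hadd hmul) : AdmitsDiophantineModel R :=
  ⟨n, _, _, _, H⟩

theorem UniformGenericModel.admits_rat (H : UniformGenericModel) : AdmitsDiophantineModel ℚ := by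
  obtain ⟨n, h, hadd, hmul, σ, hσ⟩ := H
  exact admits_rat_of_isDioph (isDioph_ringOf_maxExtension σ)
    (hσ _ (maxExtension_mem σ) (isHTPGeneric_maxExtension σ)).admits

/-! ### Baire category -/

theorem countable_intMvPolynomial (σ : Type*) [Countable σ] : Countable (MvPolynomial σ ℤ) :=
  Function.Injective.countable (f := fun f : MvPolynomial σ ℤ => AddMonoidAlgebra.coeff f)
    AddMonoidAlgebra.coeff_injective

theorem isMeagre_compl_setOf_isHTPGeneric : IsMeagre {W : PrimeSet | IsHTPGeneric W}ᶜ := by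
  have hc := countable_intMvPolynomial ℕ
  have : {W : PrimeSet | IsHTPGeneric W}ᶜ = ⋃ f : MvPolynomial ℕ ℤ, frontier (solvableSet f) := by
    ext W
    simp [IsHTPGeneric]
  rw [this]
  refine isMeagre_iUnion fun f => IsNowhereDense.isMeagre ?_
  rw [isClosed_frontier.isNowhereDense_iff]
  rw [← frontier_compl]
  exact interior_frontier (isOpen_solvableSet f).isClosed_compl

theorem UniformGenericModel.not_isMeagre (H : UniformGenericModel) :
    ¬ IsMeagre diophantineClass := by
  obtain ⟨n, h, hadd, hmul, σ, hσ⟩ := H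
  intro hm
  refine not_isMeagre_of_isOpen (isOpen_basicOpen σ) ⟨_, maxExtension_mem σ⟩
    ((hm.union isMeagre_compl_setOf_isHTPGeneric).mono fun V hV => ?_)
  by_cases hg : IsHTPGeneric V
  · exact Or.inl (hσ V hV hg).admits
  · exact Or.inr hg

theorem exists_basicOpen_subset {O : Set PrimeSet} (hO : IsOpen O) {V : PrimeSet} (hV : V ∈ O) :
    ∃ σ, V ∈ basicOpen σ ∧ basicOpen σ ⊆ O := by
  obtain ⟨I, u, hu, hsub⟩ := isOpen_pi_iff.1 hO V hV
  obtain ⟨N, hN⟩ : ∃ N, ∀ p ∈ I, Function.surjInv nthPrime_surjective p < N :=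
    ⟨I.sup (Function.surjInv nthPrime_surjective) + 1, fun p hp =>
      Nat.lt_succ_of_le (Finset.le_sup (f := Function.surjInv nthPrime_surjective) hp)⟩
  refine ⟨(List.range N).map fun i => V (nthPrime i), fun i hi => by simp, fun W hW => hsub ?_⟩
  intro p hp
  have h1 := hW (Function.surjInv nthPrime_surjective p) (by simpa using hN p hp)
  simp only [List.getElem_map, List.getElem_range, Function.surjInv_eq] at h1
  rw [h1]
  exact (hu p hp).2

/-! ### A dense set of models yields a model at every generic point -/

section GenericModel

variable {n : ℕ} (h : MvPolynomial (Fin n ⊕ ℕ) ℤ)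
  (hadd hmul : MvPolynomial ((Fin 3 × Fin n) ⊕ ℕ) ℤ) (v : Fin n → ℚ)

/-- `e` is the isomorphism of a model of `ℤ` in `R_W` by `(h, hadd, hmul)`, and `v` represents `1`. -/
def IsModelAt (W : PrimeSet) (e : ℤ → Fin n → ℚ) : Prop :=
  IsModelMap e (ratSolutions (ringOf W) h) (ratSolutions (ringOf W) hadd)
    (ratSolutions (ringOf W) hmul) ∧ e 1 = v

/-- The sets `W` for which `(h, hadd, hmul)` is a model in `R_W` in which `v` represents `1`. -/
def modelSet : Set PrimeSet := {W | ∃ e, IsModelAt h hadd hmul v W e}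

variable {h hadd hmul v}

theorem sup_mem_basicOpen {σ : List Bool} {W W' : PrimeSet} (hW : W ∈ basicOpen σ)
    (hW' : W' ∈ basicOpen σ) : W ⊔ W' ∈ basicOpen σ := fun i hi => by
  rw [Pi.sup_apply, hW i hi, hW' i hi, sup_idem]

variable {σ : List Bool} (hσ : basicOpen σ ⊆ closure (modelSet h hadd hmul v))

include hσ in
theorem exists_isModelAt_mem {O : Set PrimeSet} (hO : IsOpen O) {W : PrimeSet}
    (hW : W ∈ basicOpen σ) (hWO : W ∈ O) :
    ∃ W' ∈ O ∩ basicOpen σ, ∃ e, IsModelAt h hadd hmul v W' e := by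
  obtain ⟨W', h1, h2⟩ := mem_closure_iff.1 (hσ hW) _ (hO.inter (isOpen_basicOpen σ)) ⟨hWO, hW⟩
  exact ⟨W', h1, h2⟩

theorem IsModelAt.concat3_mem {W : PrimeSet} {e : ℤ → Fin n → ℚ} (he : IsModelAt h hadd hmul v W e)
    (a b : ℤ) : concat3 (e a) (e b) (e (a + b)) ∈ ratSolutions (ringOf W) hadd :=
  (he.1.add_iff _ _ _).2 ⟨a, b, rfl, rfl, rfl⟩

include hσ in
/-- Graph facts at two models in `𝒰_σ` hold simultaneously in a third. -/
theorem exists_isModelAt_of_mem_of_mem {W W' : PrimeSet} (hW : W ∈ basicOpen σ)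
    (hW' : W' ∈ basicOpen σ) {x y : Fin 3 × Fin n → ℚ} (hx : x ∈ ratSolutions (ringOf W) hadd)
    (hy : y ∈ ratSolutions (ringOf W') hadd) :
    ∃ W'' e, IsModelAt h hadd hmul v W'' e ∧ x ∈ ratSolutions (ringOf W'') hadd ∧
      y ∈ ratSolutions (ringOf W'') hadd := by
  -- Both facts hold at `W ⊔ W'` by monotonicity, hence on a neighbourhood, where density supplies a
  -- model.
  obtain ⟨W'', ⟨⟨h1, h2⟩, -⟩, e, he⟩ := exists_isModelAt_mem hσ
    ((isOpen_setOf_mem_ratSolutions hadd x).inter (isOpen_setOf_mem_ratSolutions hadd y))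
    (sup_mem_basicOpen hW hW')
    ⟨mem_ratSolutions_mono le_sup_left hx, mem_ratSolutions_mono le_sup_right hy⟩
  exact ⟨W'', e, he, h1, h2⟩

include hσ in
-- Induction in both directions from `1`, whose image `v` is fixed: the two triples for adding `1`
-- lie in the addition graph of one common model, which determines both the sum and, by
-- cancellation, the summand.
theorem IsModelAt.apply_eq {W W' : PrimeSet} (hW : W ∈ basicOpen σ) (hW' : W' ∈ basicOpen σ)
    {e e' : ℤ → Fin n → ℚ} (he : IsModelAt h hadd hmul v W e)
    (he' : IsModelAt h hadd hmul v W' e') (k : ℤ) : e k = e' k := by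
  induction k using Int.inductionOn' (b := 1) with
  | zero => rw [he.2, he'.2]
  | succ k _ ih =>
    have h1 := he.concat3_mem k 1
    have h2 := he'.concat3_mem k 1
    obtain ⟨W'', e'', he'', h1, h2⟩ := exists_isModelAt_of_mem_of_mem hσ hW hW' h1 h2
    obtain ⟨a, b, ha, hb, hab⟩ := (he''.1.add_iff _ _ _).1 h1
    obtain ⟨a', b', ha', hb', hab'⟩ := (he''.1.add_iff _ _ _).1 h2
    rw [← ih, ha] at ha'
    rw [he'.2, ← he.2, hb] at hb'
    rw [hab, hab', he''.1.injective ha', he''.1.injective hb']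
  | pred k _ ih =>
    have h1 := he.concat3_mem (k - 1) 1
    have h2 := he'.concat3_mem (k - 1) 1
    rw [sub_add_cancel] at h1 h2
    obtain ⟨W'', e'', he'', h1, h2⟩ := exists_isModelAt_of_mem_of_mem hσ hW hW' h1 h2
    obtain ⟨a, b, ha, hb, hab⟩ := (he''.1.add_iff _ _ _).1 h1
    obtain ⟨a', b', ha', hb', hab'⟩ := (he''.1.add_iff _ _ _).1 h2
    rw [← ih, hab] at hab'
    rw [he'.2, ← he.2, hb] at hb'
    have hbb := he''.1.injective hb'
    have hs := he''.1.injective hab'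
    rw [ha, ha', show a = a' by omega]

include hσ in
theorem IsHTPGeneric.exists_isModelAt {V : PrimeSet} (hV : IsHTPGeneric V)
    (hVσ : V ∈ basicOpen σ) : ∃ e, IsModelAt h hadd hmul v V e := by
  obtain ⟨W₀, ⟨-, hW₀⟩, e, he⟩ := exists_isModelAt_mem hσ isOpen_univ hVσ (Set.mem_univ V)
  have hconst : ∀ W ∈ basicOpen σ, ∀ e', IsModelAt h hadd hmul v W e' →
      IsModelAt h hadd hmul v W e := by
    intro W hW e' he'
    rwa [show e = e' from funext fun k => IsModelAt.apply_eq hσ hW₀ hW he he' k]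
  -- Facts true at all models hold at points accumulating at `V`, and a generic `V` inherits them;
  -- `hnear` is the converse passage, by openness.
  have hfact : ∀ {ι : Type} [Fintype ι] (g : MvPolynomial (ι ⊕ ℕ) ℤ) (x : ι → ℚ),
      (∀ W, IsModelAt h hadd hmul v W e → x ∈ ratSolutions (ringOf W) g) →
      x ∈ ratSolutions (ringOf V) g := by
    intro ι _ g x hx
    refine hV.mem_ratSolutions (mem_closure_iff.2 fun O hO hVO => ?_)
    obtain ⟨W, ⟨hWO, hW⟩, e', he'⟩ := exists_isModelAt_mem hσ hO hVσ hVO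
    exact ⟨W, hWO, hx W (hconst W hW e' he')⟩
  have hnear : ∀ {ι : Type} [Fintype ι] (g : MvPolynomial (ι ⊕ ℕ) ℤ) (x : ι → ℚ),
      x ∈ ratSolutions (ringOf V) g →
      ∃ W, IsModelAt h hadd hmul v W e ∧ x ∈ ratSolutions (ringOf W) g := by
    intro ι _ g x hx
    obtain ⟨W, ⟨hWO, hW⟩, e', he'⟩ :=
      exists_isModelAt_mem hσ (isOpen_setOf_mem_ratSolutions g x) hVσ hx
    exact ⟨W, hconst W hW e' he', hWO⟩
  refine ⟨e, ⟨he.1.injective, Set.Subset.antisymm ?_ ?_, fun x₁ x₂ x₃ => ⟨fun hx => ?_, ?_⟩,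
    fun x₁ x₂ x₃ => ⟨fun hx => ?_, ?_⟩⟩, he.2⟩
  · rintro _ ⟨k, rfl⟩
    exact hfact h _ fun W hW => hW.1.range_eq ▸ ⟨k, rfl⟩
  · intro x hx
    obtain ⟨W, hW, hxW⟩ := hnear h x hx
    rwa [hW.1.range_eq]
  · obtain ⟨W, hW, hxW⟩ := hnear hadd _ hx
    exact (hW.1.add_iff _ _ _).1 hxW
  · exact fun hx => hfact hadd _ fun W hW => (hW.1.add_iff _ _ _).2 hx
  · obtain ⟨W, hW, hxW⟩ := hnear hmul _ hx
    exact (hW.1.mul_iff _ _ _).1 hxW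
  · exact fun hx => hfact hmul _ fun W hW => (hW.1.mul_iff _ _ _).2 hx

end GenericModel

theorem uniformGenericModel_of_not_isMeagre (H : ¬ IsMeagre diophantineClass) :
    UniformGenericModel := by
  have hc1 := fun n : ℕ => countable_intMvPolynomial (Fin n ⊕ ℕ)
  have hc2 := fun n : ℕ => countable_intMvPolynomial ((Fin 3 × Fin n) ⊕ ℕ)
  -- The index set is countable, since `v` is a rational tuple and the polynomials have integer
  -- coefficients; hence one piece is nonmeager.
  obtain ⟨⟨n, h, hadd, hmul, v⟩, hi⟩ : ∃ i : Σ n : ℕ, MvPolynomial (Fin n ⊕ ℕ) ℤ ×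
      MvPolynomial ((Fin 3 × Fin n) ⊕ ℕ) ℤ × MvPolynomial ((Fin 3 × Fin n) ⊕ ℕ) ℤ × (Fin n → ℚ),
      ¬ IsMeagre (modelSet i.2.1 i.2.2.1 i.2.2.2.1 i.2.2.2.2) := by
    by_contra hn
    push Not at hn
    refine H ((isMeagre_iUnion hn).mono fun W hW => ?_)
    obtain ⟨n, h, hadd, hmul, hm⟩ := (admits_iff_exists_via (Subring.exists_int_mul_eq _)).1 hW
    obtain ⟨e, he⟩ := admitsVia_iff.1 hm
    exact Set.mem_iUnion.2 ⟨⟨n, h, hadd, hmul, e 1⟩, e, he, rfl⟩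
  have hne : (interior (closure (modelSet h hadd hmul v))).Nonempty :=
    Set.nonempty_iff_ne_empty.2 fun h0 => hi (IsNowhereDense.isMeagre h0)
  obtain ⟨V, hV⟩ := hne
  obtain ⟨σ, -, hσ⟩ := exists_basicOpen_subset isOpen_interior hV
  refine ⟨n, h, hadd, hmul, σ, fun V hVσ hV => admitsVia_iff.2 ?_⟩
  obtain ⟨e, he⟩ := hV.exists_isModelAt (hσ.trans interior_subset) hVσ
  exact ⟨e, he.1⟩

theorem theorem5p2 :
    (IsMeagre diophantineClass ∨ UniformGenericModel) ∧
    ¬ (IsMeagre diophantineClass ∧ UniformGenericModel) ∧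
    (UniformGenericModel →
      (fun _ => true) ∈ diophantineClass ∧ AdmitsDiophantineModel ℚ) := by
  refine ⟨or_iff_not_imp_left.2 uniformGenericModel_of_not_isMeagre,
    fun h => h.2.not_isMeagre h.1, fun h => ⟨?_, h.admits_rat⟩⟩
  change AdmitsDiophantineModel (ringOf fun _ => true)
  rw [ringOf_true]
  exact admits_top_iff.2 h.admits_rat
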